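/- Let $n\ge 1$ and let $\mathrm{Dis}(n)$ be the set of partitions of $n$ into distinct positive parts (written in decreasing order), ordered by majorization: $\beta\succeq\alpha$ if $\beta_1+\dots+\beta_i\ge\alpha_1+\dots+\alpha_i$ for all $i$ up to the smaller of the two numbers of parts. An $S$-block is a pair $[\alpha|\beta]$ with $\alpha,\beta\in\mathrm{Dis}(n)$, $\beta\succeq\alpha$, and $\mathrm{len}(\alpha)\in\{\mathrm{len}(\beta),\mathrm{len}(\beta)+1\}$. The $S$-blocks form a poset under $[\alpha_1|\beta_1]\succeq[\alpha_2|\beta_2]\iff\alpha_1\succeq\alpha_2$ and $\beta_2\succeq\beta_1$; add a new minimum $\hat 0$ and a new maximum $\hat 1$ to it. For a finite graph $G$ with degree sequence $\pi$ (isolated vertices ignored), let $\alpha(\pi)$ list the nonzero lengths of the rows of the Ferrers diagram of $\pi$ counted from the main diagonal (inclusive) to the right, and $\beta(\pi)$ the nonzero lengths of its columns strictly below the main diagonal. $G$ is an NG-graph if $\chi(G)+\chi(\overline G)=|V(G)|+1$; with $A_G=\{v:\deg v=\chi(G)-1\}$, an NG-graph $G$ is NG-1 if $A_G$ is a clique and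 NG-2 if $A_G$ is a stable set. An $S$-block is NG-$i$ if it equals $[\alpha(\pi)|\beta(\pi)]$ for the degree sequence $\pi$ of some NG-$i$ graph. For $n\ge\binom{k+1}{2}$ let $NG_i(n,k)$ $(i=1,2)$ be the set of NG-$i$ $S$-blocks $[\alpha|\beta]$ with $\alpha,\beta\in\mathrm{Dis}(n)$ both having exactly $k$ parts, and let $NG_1^*(n,k)=NG_1(n,k)\setminus NG_2(n,k)$, $NG_2^*(n,k)=NG_2(n,k)\setminus NG_1(n,k)$. **Theorem.** Let $x=[\alpha_1|\beta_1]$ and $y=[\alpha_2|\beta_2]$ be $S$-blocks, with meets and joins of blocks taken in the poset of $S$-blocks with $\hat 0,\hat 1$ added, and those of partitions in $\mathrm{Dis}(n)$. In each of the following cases the meet and join named exist, and: 1. for $i\in\{1,2\}$, if $x,y\in NG_i(n,k)$, then $x\wedge y\in NG_i(n,k)$, and $x\vee y\in NG_i(n,k)$ or $x\vee y=\hat 1$; 2. for $i\in\{1,2\}$, if $x,y\in NG_i^*(n,k)$, then $x\wedge y\in NG_i^*(n,k)$, and $x\vee y\in NG_i^*(n,k)$ or $x\vee y=\hat 1$;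 3. if $x\in NG_1^*(n,k)$ and $y\in NG_2^*(n,k)$, then $x\wedge y\in NG_1(n,k)\cap NG_2(n,k)$ and $x\vee y=\hat 1$. Moreover, in each of these cases $\alpha_1\vee\alpha_2$ and $\beta_1\wedge\beta_2$ exist in $\mathrm{Dis}(n)$, and $x\vee y=\hat 1$ precisely when $\beta_1\wedge\beta_2\not\succeq\alpha_1\vee\alpha_2$. -/

import Mathlib

namespace SplitBlock

/-! ## Partitions into distinct parts and majorization -/

/-- `Dis n`: partitions of `n` into distinct positive parts, written in decreasing order. -/
@[ext]
structure Dis (n : ℕ) where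
  parts : List ℕ
  decreasing : parts.Pairwise (· > ·)
  pos : ∀ p ∈ parts, 0 < p
  sum_eq : parts.sum = n

/-- The number of parts. -/
def Dis.len {n : ℕ} (γ : Dis n) : ℕ := γ.parts.length

/-- `Majorizes b a`: every partial sum of `b` is at least the corresponding partial sum of `a`,
up to the smaller of the two lengths. -/
def Majorizes (b a : List ℕ) : Prop :=
  ∀ k ≤ min a.length b.length, (a.take k).sum ≤ (b.take k).sum

theorem take_sum_le (l : List ℕ) (k : ℕ) : (l.take k).sum ≤ l.sum := by
  conv_rhs => rw [← List.take_append_drop k l, List.sum_append]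
  omega

/-- For lists with the same sum the bound on the number of summands is immaterial. -/
theorem majorizes_iff {a b : List ℕ} (h : a.sum = b.sum) :
    Majorizes b a ↔ ∀ k, (a.take k).sum ≤ (b.take k).sum := by
  refine ⟨fun H k => ?_, fun H k _ => H k⟩
  rcases le_total b.length k with hb | hb
  · rw [List.take_of_length_le hb, ← h]
    exact take_sum_le a k
  rcases le_total a.length k with ha | ha
  · have h1 := H a.length (by simp; omega)
    rw [List.take_of_length_le le_rfl] at h1
    rw [List.take_of_length_le ha]
    refine h1.trans ?_
    have h2 := take_sum_le (b.take k) a.length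
    rwa [List.take_take, min_eq_left ha] at h2
  · exact H k (le_min ha hb)

/-- A list of positive numbers is determined by its partial sums. -/
theorem eq_of_take_sum_eq : ∀ {a b : List ℕ}, (∀ p ∈ a, 0 < p) → (∀ p ∈ b, 0 < p) →
    (∀ k, (a.take k).sum = (b.take k).sum) → a = b
  | [], [], _, _, _ => rfl
  | [], y :: b, _, hb, h => by
      have h1 := h 1
      have h2 := hb y (by simp)
      simp at h1
      omega
  | x :: a, [], ha, _, h => by
      have h1 := h 1
      have h2 := ha x (by simp)
      simp at h1
      omega
  | x :: a, y :: b, ha, hb, h => by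
      have h1 : x = y := by simpa using h 1
      subst h1
      have h2 : a = b := eq_of_take_sum_eq
        (fun p hp => ha p (List.mem_cons_of_mem _ hp))
        (fun p hp => hb p (List.mem_cons_of_mem _ hp))
        (fun k => by simpa using h (k + 1))
      rw [h2]

theorem Dis.sum_eq_sum {n : ℕ} (γ δ : Dis n) : γ.parts.sum = δ.parts.sum :=
  γ.sum_eq.trans δ.sum_eq.symm

/-- `Dis n` ordered by majorization: `α ≤ β` when `β` majorizes `α`. -/
instance Dis.instPartialOrder (n : ℕ) : PartialOrder (Dis n) where
  le α β := Majorizes β.parts α.parts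
  le_refl _ := fun _ _ => le_rfl
  le_trans α β γ h₁ h₂ := by
    rw [majorizes_iff (Dis.sum_eq_sum _ _)] at *
    exact fun k => (h₁ k).trans (h₂ k)
  le_antisymm α β h₁ h₂ := by
    rw [majorizes_iff (Dis.sum_eq_sum _ _)] at *
    exact Dis.ext (eq_of_take_sum_eq α.pos β.pos (fun k => le_antisymm (h₁ k) (h₂ k)))

/-! ## The poset of S-blocks -/

/-- An S-block `[α|β]`, with `α` and `β` partitions of the same number `n` into distinct parts. -/
@[ext]
structure SBlock (n : ℕ) where
  α : Dis n
  β : Dis n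
  maj : α ≤ β
  len_eq : α.len = β.len ∨ α.len = β.len + 1

/-- `[α₁|β₁]` majorizes `[α₂|β₂]` when `α₁` majorizes `α₂` and `β₂` majorizes `β₁`. -/
instance SBlock.instPartialOrder (n : ℕ) : PartialOrder (SBlock n) where
  le x y := x.α ≤ y.α ∧ y.β ≤ x.β
  le_refl _ := ⟨le_rfl, le_rfl⟩
  le_trans _ _ _ h₁ h₂ := ⟨h₁.1.trans h₂.1, h₂.2.trans h₁.2⟩
  le_antisymm _ _ h₁ h₂ := SBlock.ext (le_antisymm h₁.1 h₂.1) (le_antisymm h₂.2 h₁.2)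

/-- The poset of S-blocks with a new minimum element `⊥` and a new maximum element `⊤`. -/
abbrev ExtSBlock (n : ℕ) : Type := WithBot (WithTop (SBlock n))

/-- An S-block as an element of the extended poset. -/
def SBlock.toExt {n : ℕ} (x : SBlock n) : ExtSBlock n := ((x : WithTop (SBlock n)) : ExtSBlock n)

/-! ## Degree sequences and the two halves of the Ferrers diagram -/

open Classical in
/-- The degree sequence of a finite graph, in non-increasing order, isolated vertices ignored. -/
noncomputable def degSeq {V : Type*} [Fintype V] (G : SimpleGraph V) : List ℕ :=
  ((Finset.univ.val.map fun v => G.degree v).filter fun d => 0 < d).sort (· ≥ ·)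

/-- Row lengths of the part of the Ferrers diagram of `d` on or to the right of the main diagonal.
With rows and columns counted from `0`, row `i` has boxes in the columns `j < d i`, and those with
`i ≤ j` are `d i - i` in number (none if `d i ≤ i`). -/
def alphaOf (d : List ℕ) : List ℕ :=
  ((List.range d.length).map fun i => d.getD i 0 - i).filter fun p => 0 < p

/-- Column lengths of the part of the Ferrers diagram of `d` strictly below the main diagonal:
column `j` has a box there in every row `i` with `j < i` and `j < d i`. -/
def betaOf (d : List ℕ) : List ℕ :=
  ((List.range d.length).map fun j =>
    ((List.range d.length).filter fun i => j < i ∧ j < d.getD i 0).length).filter fun p => 0 < p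

/-! ## Nordhaus-Gaddum graphs -/

/-- `χ(G) + χ(Gᶜ) = |V| + 1`. -/
def IsNG {V : Type*} [Fintype V] (G : SimpleGraph V) : Prop :=
  G.chromaticNumber + Gᶜ.chromaticNumber = (Fintype.card V : ℕ∞) + 1

open Classical in
/-- The part `A` of the ABC-partition: the vertices of degree `χ(G) - 1`. -/
def partA {V : Type*} [Fintype V] (G : SimpleGraph V) : Set V :=
  {v | (G.degree v : ℕ∞) + 1 = G.chromaticNumber}

/-- NG-1 graphs: NG-graphs in which `A` is a clique. -/
def IsNG1Graph {V : Type*} [Fintype V] (G : SimpleGraph V) : Prop :=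
  IsNG G ∧ G.IsClique (partA G)

/-- NG-2 graphs: NG-graphs in which `A` is a stable set. -/
def IsNG2Graph {V : Type*} [Fintype V] (G : SimpleGraph V) : Prop :=
  IsNG G ∧ G.IsIndepSet (partA G)

/-- The S-block is the pair `[α(π)|β(π)]` for the degree sequence `π` of `G`. -/
def SBlock.IsBlockOf {n : ℕ} (x : SBlock n) {V : Type*} [Fintype V] (G : SimpleGraph V) : Prop :=
  alphaOf (degSeq G) = x.α.parts ∧ betaOf (degSeq G) = x.β.parts

/-- An S-block is NG-1 if it arises from the degree sequence of some NG-1 graph. -/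
def SBlock.IsNG1 {n : ℕ} (x : SBlock n) : Prop :=
  ∃ (N : ℕ) (G : SimpleGraph (Fin N)), IsNG1Graph G ∧ x.IsBlockOf G

/-- An S-block is NG-2 if it arises from the degree sequence of some NG-2 graph. -/
def SBlock.IsNG2 {n : ℕ} (x : SBlock n) : Prop :=
  ∃ (N : ℕ) (G : SimpleGraph (Fin N)), IsNG2Graph G ∧ x.IsBlockOf G

/-! ## The amphoras -/

/-- `A(n,k)`: the S-blocks `[α|β]` in which both `α` and `β` have exactly `k` parts. -/
def amphora (n k : ℕ) : Set (SBlock n) := {x | x.α.len = k ∧ x.β.len = k}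

def NG1 (n k : ℕ) : Set (SBlock n) := {x | x ∈ amphora n k ∧ x.IsNG1}

def NG2 (n k : ℕ) : Set (SBlock n) := {x | x ∈ amphora n k ∧ x.IsNG2}

/-- `NG*₁(n,k)`: the blocks in `NG₁(n,k)` that are not in `NG₂(n,k)`. -/
def NG1Star (n k : ℕ) : Set (SBlock n) := NG1 n k \ NG2 n k

/-- `NG*₂(n,k)`: the blocks in `NG₂(n,k)` that are not in `NG₁(n,k)`. -/
def NG2Star (n k : ℕ) : Set (SBlock n) := NG2 n k \ NG1 n k

/-- One row of the table. For `x = [α₁|β₁] ∈ S` and `y = [α₂|β₂] ∈ T`, computed in the extended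
poset: the meet `x ∧ y` exists and lies in `M`, and the join `x ∨ y` exists and lies in `J`.
Moreover `α₁ ∨ α₂` and `β₁ ∧ β₂` exist in `Dis n`, and `x ∨ y` is the added maximum exactly when
`β₁ ∧ β₂` does not majorize `α₁ ∨ α₂`. -/
def TableRow {n : ℕ} (S T M : Set (SBlock n)) (J : Set (ExtSBlock n)) : Prop :=
  ∀ x ∈ S, ∀ y ∈ T,
    (∃ m ∈ M, IsGLB {x.toExt, y.toExt} m.toExt) ∧
    (∃ j ∈ J, IsLUB {x.toExt, y.toExt} j ∧
      ∃ a b : Dis n, IsLUB {x.α, y.α} a ∧ IsGLB {x.β, y.β} b ∧ (j = ⊤ ↔ ¬ a ≤ b))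

/-- The elements of the extended poset that are `⊤` or an S-block in `S`. -/
def orTop {n : ℕ} (S : Set (SBlock n)) : Set (ExtSBlock n) := SBlock.toExt '' S ∪ {⊤}

end SplitBlock

namespace SplitBlock

/-! ## The lattice of partitions into distinct parts -/

/-! When both halves of a block have `m + 1` parts, its NG-type depends on the last parts alone. The
halves of the Ferrers diagram both have `n` boxes, which is equality in an Erdős–Gallai inequality;
hence every graph with this block is split and is an NG-graph, and `A` is a clique iff the last part
of `β` is 1, a stable set iff the last part of `α` is at least 2 (`SBlock.IsBlockOf.isNG`).
Conversely, majorization is the Gale–Ryser condition for choosing the edges between the clique and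
the stable set, so every such block is realized (`SBlock.exists_isBlockOf`).

Let `a ≤ b < n` be the sums of the first `m` parts of `α` and `β`. Then NG-1 means `b = n - 1`, NG-2
means `a ≤ n - 2`, and the starred classes are `a = n - 1` and `b ≤ n - 2` respectively.

Infima in `Dis n` are pointwise minima of partial sums; suprema are infima of sets of upper bounds.
If two partitions with `m + 1` parts have last part at least `e`, so does their supremum, because of
the common upper bound ending in `…, e + 2, e + 1, e` (`Dis.exists_upperBound`). Blocks are combined
half by half, and the join is the added maximum exactly when the resulting halves fail to be
comparable as required. Every case is then linear arithmetic in `a` and `b`; in the mixed case a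
join block would have `a ≥ n - 1` and `b ≤ n - 2`. -/

theorem sum_take_succ_getD (l : List ℕ) (i : ℕ) :
    (l.take (i + 1)).sum = (l.take i).sum + l.getD i 0 := by
  rw [List.take_add_one, List.sum_append, List.getD_eq_getElem?_getD]
  rcases l[i]? with _ | x <;> simp

namespace Dis

variable {n : ℕ}

/-- The `i`-th part, counted from `0`, and `0` beyond the last one. -/
def part (γ : Dis n) (i : ℕ) : ℕ := γ.parts.getD i 0

/-- The sum of the first `i` parts. -/
def psum (γ : Dis n) (i : ℕ) : ℕ := (γ.parts.take i).sum

theorem psum_zero (γ : Dis n) : γ.psum 0 = 0 := by simp [psum]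

theorem psum_succ (γ : Dis n) (i : ℕ) : γ.psum (i + 1) = γ.psum i + γ.part i :=
  sum_take_succ_getD _ _

theorem psum_eq_sum (γ : Dis n) (i : ℕ) : γ.psum i = ∑ j ∈ Finset.range i, γ.part j := by
  induction i with
  | zero => simp [psum_zero]
  | succ i ih => rw [psum_succ, ih, Finset.sum_range_succ]

theorem le_iff {γ δ : Dis n} : γ ≤ δ ↔ ∀ i, γ.psum i ≤ δ.psum i :=
  majorizes_iff (sum_eq_sum γ δ)

theorem psum_le (γ : Dis n) (i : ℕ) : γ.psum i ≤ n :=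
  (take_sum_le _ _).trans γ.sum_eq.le

theorem psum_mono (γ : Dis n) (i : ℕ) : γ.psum i ≤ γ.psum (i + 1) := by
  rw [psum_succ]; omega

theorem psum_of_len_le (γ : Dis n) {i : ℕ} (h : γ.len ≤ i) : γ.psum i = n := by
  rw [psum, List.take_of_length_le h, γ.sum_eq]

theorem part_pos_iff (γ : Dis n) {i : ℕ} : 0 < γ.part i ↔ i < γ.len := by
  unfold part len
  refine ⟨fun h => ?_, fun h => ?_⟩
  · by_contra hi
    rw [List.getD_eq_default _ _ (not_lt.1 hi)] at h
    omega
  · rw [List.getD_eq_getElem _ _ h]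
    exact γ.pos _ (List.getElem_mem h)

theorem part_succ_lt (γ : Dis n) {i : ℕ} (h : i < γ.len) : γ.part (i + 1) < γ.part i := by
  by_cases h' : i + 1 < γ.len
  · unfold part
    rw [List.getD_eq_getElem _ _ h', List.getD_eq_getElem _ _ h]
    exact List.pairwise_iff_getElem.1 γ.decreasing i (i + 1) h h' (by omega)
  · have h1 := (part_pos_iff γ).2 h
    have h2 := mt (part_pos_iff γ).1 h'
    omega

theorem psum_lt_iff (γ : Dis n) {i : ℕ} : γ.psum i < n ↔ i < γ.len := by
  refine ⟨fun h => ?_, fun h => ?_⟩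
  · by_contra hi
    rw [psum_of_len_le γ (not_lt.1 hi)] at h
    omega
  · have h1 := (part_pos_iff γ).2 h
    have h2 := psum_succ γ i
    have h3 := psum_le γ (i + 1)
    omega

/-- Distinct parts are strict concavity of the partial sums, but only until the total is reached;
afterwards the sums are constant. -/
theorem psum_concave (γ : Dis n) {i : ℕ} (h : γ.psum i < n) :
    γ.psum i + γ.psum (i + 2) < 2 * γ.psum (i + 1) := by
  have h1 := part_succ_lt γ ((psum_lt_iff γ).1 h)
  have h2 := psum_succ γ i
  have h3 := psum_succ γ (i + 1)
  have h4 : γ.psum (i + 2) = γ.psum (i + 1 + 1) := rfl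
  omega

theorem len_le (γ : Dis n) : γ.len ≤ n := by
  have : ∀ i ≤ γ.len, i ≤ γ.psum i := by
    intro i
    induction i with
    | zero => simp
    | succ i ih =>
      intro hi
      have h1 := (part_pos_iff γ (i := i)).2 (by omega)
      have h2 := psum_succ γ i
      have := ih (by omega)
      omega
  exact (this _ le_rfl).trans (psum_le _ _)

theorem len_eq_iff (γ : Dis n) {m : ℕ} :
    γ.len = m + 1 ↔ γ.psum m < n ∧ γ.psum (m + 1) = n := by
  have h1 := psum_lt_iff γ (i := m)
  have h2 := psum_lt_iff γ (i := m + 1)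
  have h3 := psum_le γ (m + 1)
  omega

/-- A strictly concave function that reaches `n` is the function of partial sums of a partition
of `n` into distinct parts. -/
theorem exists_psum_eq {M : ℕ → ℕ} (h0 : M 0 = 0) (hmono : ∀ i, M i ≤ M (i + 1))
    (hle : ∀ i, M i ≤ n) (hex : ∃ i, M i = n)
    (hconc : ∀ i, M i < n → M i + M (i + 2) < 2 * M (i + 1)) :
    ∃ γ : Dis n, ∀ i, γ.psum i = M i := by
  classical
  have hm : Monotone M := monotone_nat_of_le_succ hmono
  -- The number of parts will be the first index at which `M` reaches `n`; the parts are the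
  -- increments of `M` before it.
  let K := Nat.find hex
  have hK : M K = n := Nat.find_spec hex
  have hlt : ∀ i < K, M i < n := fun i hi => lt_of_le_of_ne (hle i) (Nat.find_min hex hi)
  have hdec : ∀ i j, i < j → j < K → M (j + 1) - M j < M (i + 1) - M i := by
    intro i j hij
    induction j, hij using Nat.le_induction with
    | base =>
      intro hj
      have h1 := hconc i (hlt i (by omega))
      have h2 := hmono i
      have h3 := hmono (i + 1)
      simp only [Nat.succ_eq_add_one, add_assoc, Nat.reduceAdd] at *
      omega
    | succ j hij ih =>
      intro hj
      have h1 := hconc j (hlt j (by omega))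
      have h2 := hmono j
      have h3 := hmono (j + 1)
      have h4 := ih (by omega)
      simp only [add_assoc, Nat.reduceAdd] at *
      omega
  have hsum : ∀ i, (((List.range K).map fun i => M (i + 1) - M i).take i).sum = M i := by
    intro i
    induction i with
    | zero => simp [h0]
    | succ i ih =>
      rw [sum_take_succ_getD, ih]
      by_cases hi : i < K
      · rw [List.getD_eq_getElem _ _ (by simpa using hi)]
        simp only [List.getElem_map, List.getElem_range]
        have := hmono i
        omega
      · rw [List.getD_eq_default _ _ (by simpa using hi)]
        have h1 := hm (not_lt.1 hi)
        have h2 := hle (i + 1)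
        have h3 := hmono i
        omega
  refine ⟨⟨(List.range K).map fun i => M (i + 1) - M i, ?_, ?_, ?_⟩, hsum⟩
  · rw [List.pairwise_iff_getElem]
    intro i j hi hj hij
    simp only [List.length_map, List.length_range] at hi hj
    simpa using hdec i j hij hj
  · intro p hp
    simp only [List.mem_map, List.mem_range] at hp
    obtain ⟨i, hi, rfl⟩ := hp
    -- The increment strictly exceeds the next one, which is nonnegative, so it is positive.
    have h1 := hconc i (hlt i hi)
    have h2 := hmono (i + 1)
    have h3 := hmono i
    simp only [add_assoc, Nat.reduceAdd] at *
    omega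
  · have := hsum K
    rwa [List.take_of_length_le (by simp), hK] at this

/-- Every nonempty set of partitions has an infimum, given by the minima of the partial sums. -/
theorem exists_isGLB {S : Set (Dis n)} (hS : S.Nonempty) :
    ∃ g, IsGLB S g ∧ ∀ i, ∃ γ ∈ S, g.psum i = γ.psum i := by
  let M : ℕ → ℕ := fun i => sInf ((fun γ : Dis n => γ.psum i) '' S)
  have hmem : ∀ i, ∃ γ ∈ S, M i = γ.psum i := fun i => by
    obtain ⟨γ, h, e⟩ := Nat.sInf_mem (hS.image fun γ : Dis n => γ.psum i)
    exact ⟨γ, h, e.symm⟩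
  have hle : ∀ i, ∀ γ ∈ S, M i ≤ γ.psum i := fun i γ h => Nat.sInf_le ⟨γ, h, rfl⟩
  obtain ⟨g, hg⟩ : ∃ g : Dis n, ∀ i, g.psum i = M i := by
    apply exists_psum_eq
    · obtain ⟨γ, -, e⟩ := hmem 0
      rw [e, psum_zero]
    · intro i
      obtain ⟨γ, h, e⟩ := hmem (i + 1)
      rw [e]
      exact (hle i γ h).trans (psum_mono γ i)
    · intro i
      obtain ⟨γ, h, e⟩ := hmem i
      rw [e]
      exact psum_le γ i
    · obtain ⟨γ, h, e⟩ := hmem n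
      exact ⟨n, e.trans (psum_of_len_le γ γ.len_le)⟩
    · intro i hi
      -- The member `γ` attaining the minimum at `i + 1` passes on its own concavity, unless its
      -- sums have reached `n` at `i`; then `M (i + 1) = n` while `M i < n`, which suffices.
      obtain ⟨γ, h, e⟩ := hmem (i + 1)
      obtain ⟨δ, h', e'⟩ := hmem i
      have a1 := hle i γ h
      have a2 := hle (i + 2) γ h
      have b1 := hle (i + 1) δ h'
      have b2 := hle (i + 2) δ h'
      have b3 := psum_le δ (i + 1)
      have c1 := psum_mono γ i
      have c2 := psum_le γ i
      have c3 := psum_concave δ (i := i) (by omega)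
      by_cases hγ : γ.psum i < n
      · have := psum_concave γ hγ
        omega
      · omega
  refine ⟨g, ⟨fun γ h => le_iff.2 fun i => (hg i).trans_le (hle i γ h), fun δ h => ?_⟩, ?_⟩
  · refine le_iff.2 fun i => ?_
    obtain ⟨γ, hγ, e⟩ := hmem i
    rw [hg, e]
    exact le_iff.1 (h hγ) i
  · intro i
    obtain ⟨γ, hγ, e⟩ := hmem i
    exact ⟨γ, hγ, (hg i).trans e⟩

/-- Walking back from the last part, which is at least `e`, each part grows by at least one. Hence
the last `t + 1` parts total at least `e + (e + 1) + … + (e + t)`. -/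
theorem tail_bound (γ : Dis n) {m e : ℕ} (h : γ.psum m + e ≤ n) (he : 0 < e)
    (hγ : γ.psum (m + 1) = n) : ∀ t ≤ m,
    γ.psum (m - t) + e + t ≤ γ.psum (m + 1 - t) ∧
    γ.psum (m - t) + ∑ s ∈ Finset.range (t + 1), (e + s) ≤ n := by
  intro t
  induction t with
  | zero => simp [hγ, h]
  | succ t ih =>
    intro ht
    obtain ⟨h1, h2⟩ := ih (by omega)
    have hn := psum_le γ (m + 1 - t)
    obtain ⟨i, rfl⟩ : ∃ i, m = i + (t + 1) := ⟨m - (t + 1), by omega⟩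
    have e1 : i + (t + 1) - t = i + 1 := by omega
    have e2 : i + (t + 1) + 1 - t = i + 2 := by omega
    have e3 : i + (t + 1) - (t + 1) = i := by omega
    have e4 : i + (t + 1) + 1 - (t + 1) = i + 1 := by omega
    rw [e1, e2] at h1
    rw [e1] at h2
    rw [e3, e4]
    have h3 := psum_mono γ i
    have h4 := psum_mono γ (i + 1)
    have h5 := psum_concave γ (i := i) (by rw [e2] at hn; omega)
    rw [Finset.sum_range_succ]
    refine ⟨by omega, by omega⟩

/-- The partitions with `m + 1` parts, the last of which is at least `e`, have a common upper
bound of the same kind. -/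
theorem exists_upperBound {m e : ℕ} (he : 0 < e) (γ₀ : Dis n) (h₀ : γ₀.psum m + e ≤ n)
    (h₀' : γ₀.psum (m + 1) = n) :
    ∃ u : Dis n, u.psum m + e ≤ n ∧ u.psum (m + 1) = n ∧
      ∀ γ : Dis n, γ.psum m + e ≤ n → γ.psum (m + 1) = n → γ ≤ u := by
  -- `T t` is the least possible total of the last `t` parts. The bound `u` attains it for all `t ≤
  -- m`, its first part absorbing the rest; hence the separate value of `M` at 0.
  let T : ℕ → ℕ := fun t => ∑ s ∈ Finset.range t, (e + s)
  have hT : ∀ t, T (t + 1) = T t + (e + t) := fun t => Finset.sum_range_succ _ _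
  have hT0 : T 0 = 0 := rfl
  have hTm : Monotone T := monotone_nat_of_le_succ fun t => by rw [hT]; omega
  have hTn : T (m + 1) ≤ n := by
    have := (tail_bound γ₀ h₀ he h₀' m le_rfl).2
    simp only [Nat.sub_self, psum_zero, zero_add] at this
    exact this
  let M : ℕ → ℕ := fun i => if i = 0 then 0 else n - T (m + 1 - i)
  have hM0 : M 0 = 0 := rfl
  have hMs : ∀ i, M (i + 1) = n - T (m - i) := fun i => by simp [M]
  have hTb : ∀ i, T (m - i) ≤ n := fun i => (hTm (by omega)).trans hTn
  obtain ⟨u, hu⟩ : ∃ u : Dis n, ∀ i, u.psum i = M i := by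
    apply exists_psum_eq hM0
    · rintro (_ | i)
      · rw [hM0]; omega
      · rw [hMs, hMs]
        have := hTm (show m - (i + 1) ≤ m - i by omega)
        omega
    · rintro (_ | i)
      · rw [hM0]; omega
      · rw [hMs]; omega
    · exact ⟨m + 1, by rw [hMs]; simp [hT0]⟩
    · rintro (_ | i) hi
      · rw [hM0, hMs 1, hMs 0]
        rcases m with _ | m
        · simp only [hT0, Nat.zero_sub]
          have := hT 0
          omega
        · have h1 := hT m
          have h2 := hT (m + 1)
          simp only [Nat.sub_zero, Nat.add_sub_cancel]
          omega
      · rw [show i + 1 + 2 = (i + 2) + 1 from rfl, hMs, hMs, hMs]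
        rw [hMs] at hi
        have hmi : i < m := by
          by_contra h
          rw [show m - i = 0 by omega, hT0] at hi
          omega
        obtain ⟨j, rfl⟩ : ∃ j, m = i + 1 + j := ⟨m - i - 1, by omega⟩
        have hb := hTb i
        rw [show i + 1 + j - i = j + 1 by omega] at hb ⊢
        rw [show i + 1 + j - (i + 1) = j by omega]
        have h1 := hT j
        rcases j with _ | j
        · rw [show i + 1 + 0 - (i + 2) = 0 by omega]
          omega
        · rw [show i + 1 + (j + 1) - (i + 2) = j by omega]
          have := hT j
          omega
  refine ⟨u, ?_, ?_, fun γ h h' => le_iff.2 fun i => ?_⟩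
  · rw [hu]
    rcases m with _ | m
    · rw [hM0, zero_add]; omega
    · rw [hMs, Nat.add_sub_cancel_left]
      have h1 := hT 0
      have h2 := hTm (show 1 ≤ m + 1 + 1 by omega)
      simp only [zero_add] at h1
      omega
  · rw [hu, hMs]; simp [hT0]
  · rw [hu]
    rcases i with _ | i
    · rw [psum_zero]; omega
    · rw [hMs]
      by_cases hi : i < m
      · have := (tail_bound γ h he h' (m - (i + 1)) (by omega)).2
        rw [show m - (m - (i + 1)) = i + 1 by omega, show m - (i + 1) + 1 = m - i by omega] at this
        change _ + T (m - i) ≤ n at this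
        omega
      · rw [show m - i = 0 by omega, hT0]
        exact psum_le _ _

end Dis

/-! ## Degree sequences as antitone functions -/

/-- In a non-increasing list the zeros form a tail, so deleting them changes no entry read with
default 0. -/
theorem getD_filter_pos (l : List ℕ) (h : ∀ i, l.getD (i + 1) 0 ≤ l.getD i 0) (i : ℕ) :
    (l.filter fun p => 0 < p).getD i 0 = l.getD i 0 := by
  induction l generalizing i with
  | nil => simp
  | cons x l ih =>
    have ih' := ih fun i => by simpa using h (i + 1)
    by_cases hx : 0 < x
    · rw [List.filter_cons_of_pos (by simpa using hx)]
      cases i with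
      | zero => simp
      | succ i => simpa using ih' i
    · have hx0 : x = 0 := by omega
      subst hx0
      have hz : ∀ i, (0 :: l).getD i 0 = 0 := by
        intro i
        induction i with
        | zero => simp
        | succ i ihi =>
          have := h i
          omega
      rw [List.filter_cons_of_neg (by simp), ih', hz]
      simpa using hz (i + 1)

theorem eq_of_getD_eq {a b : List ℕ} (ha : ∀ p ∈ a, 0 < p) (hb : ∀ p ∈ b, 0 < p)
    (h : ∀ i, a.getD i 0 = b.getD i 0) : a = b := by
  refine eq_of_take_sum_eq ha hb fun k => ?_
  induction k with
  | zero => simp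
  | succ k ih => rw [sum_take_succ_getD, sum_take_succ_getD, ih, h]

theorem getD_map_range (f : ℕ → ℕ) (N i : ℕ) :
    ((List.range N).map f).getD i 0 = if i < N then f i else 0 := by
  split_ifs with hi
  · rw [List.getD_eq_getElem _ _ (by simpa using hi)]
    simp
  · exact List.getD_eq_default _ _ (by simpa using hi)

theorem alphaOf_getD {d : List ℕ} (h : Antitone fun i => d.getD i 0) (i : ℕ) :
    (alphaOf d).getD i 0 = d.getD i 0 - i := by
  have key : ∀ i, ((List.range d.length).map fun i => d.getD i 0 - i).getD i 0
      = d.getD i 0 - i := by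
    intro i
    rw [getD_map_range]
    split_ifs with hi
    · rfl
    · rw [List.getD_eq_default _ _ (not_lt.1 hi), Nat.zero_sub]
  rw [alphaOf, getD_filter_pos, key]
  intro i
  rw [key, key]
  have := h (Nat.le_succ i)
  simp only [Nat.succ_eq_add_one] at this
  omega

/-- The length of the `j`-th column below the diagonal of a Ferrers diagram with row lengths
`D 0, …, D (N - 1)`. -/
def colBelow (D : ℕ → ℕ) (N j : ℕ) : ℕ :=
  ((Finset.range N).filter fun i => j < i ∧ j < D i).card

/-- Needed because `degSeq` drops isolated vertices and may be shorter than the number of vertices.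
-/
theorem colBelow_congr {D : ℕ → ℕ} {M N : ℕ} (hM : ∀ i, M ≤ i → D i = 0)
    (hN : ∀ i, N ≤ i → D i = 0) (j : ℕ) : colBelow D M j = colBelow D N j := by
  unfold colBelow
  congr 1
  ext i
  simp only [Finset.mem_filter, Finset.mem_range]
  have h1 := hM i
  have h2 := hN i
  constructor <;> rintro ⟨a, b, c⟩ <;> refine ⟨?_, b, c⟩ <;> by_contra <;> omega

theorem betaOf_getD (d : List ℕ) (j : ℕ) :
    (betaOf d).getD j 0 = colBelow (fun i => d.getD i 0) d.length j := by
  have hlen : ∀ j, ((List.range d.length).filter fun i => j < i ∧ j < d.getD i 0).length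
      = colBelow (fun i => d.getD i 0) d.length j := by
    intro j
    rfl
  have key : ∀ j, ((List.range d.length).map fun j =>
      ((List.range d.length).filter fun i => j < i ∧ j < d.getD i 0).length).getD j 0
      = colBelow (fun i => d.getD i 0) d.length j := by
    intro j
    rw [getD_map_range]
    split_ifs with hj
    · exact hlen j
    · symm
      rw [colBelow, Finset.card_eq_zero, Finset.filter_eq_empty_iff]
      intro i hi
      rw [Finset.mem_range] at hi
      omega
  rw [betaOf, getD_filter_pos, key]
  intro i
  rw [key, key]
  apply Finset.card_le_card
  intro a
  simp only [Finset.mem_filter]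
  rintro ⟨h1, h2, h3⟩
  exact ⟨h1, by omega, by omega⟩

open Classical in
/-- `D` lists the degrees of the vertices of `G` in non-increasing order, followed by zeros; the
vertices are ordered by `f`. -/
structure IsDegFun {V : Type*} [Fintype V] (G : SimpleGraph V) {N : ℕ} (f : Fin N ≃ V)
    (D : ℕ → ℕ) : Prop where
  anti : Antitone D
  deg : ∀ i, G.degree (f i) = D i
  zero : ∀ i, N ≤ i → D i = 0

open Classical in
theorem exists_isDegFun {V : Type*} [Fintype V] (G : SimpleGraph V) :
    ∃ (f : Fin (Fintype.card V) ≃ V) (D : ℕ → ℕ), IsDegFun G f D := by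
  let e := (Fintype.equivFin V).symm
  let g : Fin (Fintype.card V) → ℕᵒᵈ := fun i => OrderDual.toDual (G.degree (e i))
  let f := (Tuple.sort g).trans e
  have hf : ∀ i j, i ≤ j → G.degree (f j) ≤ G.degree (f i) := fun i j hij =>
    OrderDual.toDual_le_toDual.1 (Tuple.monotone_sort g hij)
  refine ⟨f, fun i => if h : i < Fintype.card V then G.degree (f ⟨i, h⟩) else 0, ?_, ?_, ?_⟩
  · intro i j hij
    dsimp only
    split_ifs with h1 h2
    · exact hf _ _ hij
    · omega
    · exact Nat.zero_le _
    · exact le_rfl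
  · intro i
    simp
  · intro i hi
    simp [not_lt.2 hi]

open Classical in
theorem IsDegFun.degSeq_eq {V : Type*} [Fintype V] {G : SimpleGraph V} {N : ℕ} {f : Fin N ≃ V}
    {D : ℕ → ℕ} (h : IsDegFun G f D) :
    degSeq G = ((List.range N).map D).filter fun d => 0 < d := by
  refine List.Perm.eq_of_pairwise' (Multiset.pairwise_sort _ _) ?_ ?_
  · refine List.Pairwise.filter _ ?_
    rw [List.pairwise_map]
    exact List.pairwise_lt_range.imp fun hij => h.anti hij.le
  · rw [← Multiset.coe_eq_coe, degSeq, Multiset.sort_eq, ← Multiset.filter_coe]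
    congr 1
    rw [← Finset.map_univ_equiv f, Finset.map_val, Multiset.map_map]
    simp only [Function.comp_def, Equiv.coe_toEmbedding, h.deg]
    rw [Fin.univ_val_map]
    congr 1
    exact List.ext_getElem (by simp) (by simp)

theorem IsDegFun.degSeq_getD {V : Type*} [Fintype V] {G : SimpleGraph V} {N : ℕ} {f : Fin N ≃ V}
    {D : ℕ → ℕ} (h : IsDegFun G f D) (i : ℕ) : (degSeq G).getD i 0 = D i := by
  have key : ∀ i, ((List.range N).map D).getD i 0 = D i := by
    intro i
    rw [getD_map_range]
    split_ifs with hi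
    · rfl
    · exact (h.zero i (not_lt.1 hi)).symm
  rw [h.degSeq_eq, getD_filter_pos _ _ i, key]
  intro i
  rw [key, key]
  exact h.anti (Nat.le_succ i)

theorem IsDegFun.isBlockOf_iff {V : Type*} [Fintype V] {G : SimpleGraph V} {N : ℕ}
    {f : Fin N ≃ V} {D : ℕ → ℕ} (h : IsDegFun G f D) {n : ℕ} (x : SBlock n) :
    x.IsBlockOf G ↔ (∀ i, x.α.part i = D i - i) ∧ ∀ j, x.β.part j = colBelow D N j := by
  have hd : (fun i => (degSeq G).getD i 0) = D := funext h.degSeq_getD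
  have ha : ∀ i, (alphaOf (degSeq G)).getD i 0 = D i - i := fun i => by
    rw [alphaOf_getD (hd ▸ h.anti), h.degSeq_getD]
  have hb : ∀ j, (betaOf (degSeq G)).getD j 0 = colBelow D N j := fun j => by
    rw [betaOf_getD, hd]
    refine colBelow_congr (fun i hi => ?_) h.zero j
    rw [← h.degSeq_getD, List.getD_eq_default _ _ hi]
  constructor
  · rintro ⟨h1, h2⟩
    exact ⟨fun i => by rw [← ha, h1]; rfl, fun j => by rw [← hb, h2]; rfl⟩
  · rintro ⟨h1, h2⟩
    refine ⟨eq_of_getD_eq ?_ x.α.pos fun i => ?_, eq_of_getD_eq ?_ x.β.pos fun j => ?_⟩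
    · intro p hp
      simpa using (List.mem_filter.1 hp).2
    · rw [ha, ← h1]; rfl
    · intro p hp
      simpa using (List.mem_filter.1 hp).2
    · rw [hb, ← h2]; rfl

/-! ## Split graphs -/

section Split

open Classical

variable {V : Type*} {G : SimpleGraph V}

/-- The number of neighbours of `v` in `K`. -/
noncomputable def degIn (G : SimpleGraph V) (K : Finset V) (v : V) : ℕ :=
  (K.filter fun w => G.Adj v w).card

theorem sum_degIn_comm (K S : Finset V) : ∑ v ∈ K, degIn G S v = ∑ v ∈ S, degIn G K v := by
  simp only [degIn, Finset.card_filter]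
  rw [Finset.sum_comm]
  simp only [G.adj_comm]

theorem degIn_le_of_mem {K : Finset V} {k : ℕ} (hK : K.card = k + 1) {v : V} (hv : v ∈ K) :
    degIn G K v ≤ k := by
  have h : (K.filter fun w => G.Adj v w) ⊆ K.erase v := by
    intro w hw
    rw [Finset.mem_filter] at hw
    exact Finset.mem_erase.2 ⟨hw.2.ne', hw.1⟩
  have := Finset.card_le_card h
  rwa [Finset.card_erase_of_mem hv, hK] at this

theorem adj_of_degIn_eq {K : Finset V} {k : ℕ} (hK : K.card = k + 1) {v : V} (hv : v ∈ K)
    (h : degIn G K v = k) {w : V} (hw : w ∈ K) (hvw : v ≠ w) : G.Adj v w := by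
  have hs : (K.filter fun w => G.Adj v w) ⊆ K.erase v := by
    intro w hw
    rw [Finset.mem_filter] at hw
    exact Finset.mem_erase.2 ⟨hw.2.ne', hw.1⟩
  have he := Finset.eq_of_subset_of_card_le hs (by
    rw [Finset.card_erase_of_mem hv, hK]
    exact h.ge)
  have : w ∈ K.erase v := Finset.mem_erase.2 ⟨hvw.symm, hw⟩
  rw [← he, Finset.mem_filter] at this
  exact this.2

variable [Fintype V]

theorem degIn_add_compl (K : Finset V) (v : V) :
    degIn G K v + degIn G Kᶜ v = G.degree v := by
  unfold degIn
  rw [← G.card_neighborFinset_eq_degree, ← Finset.card_union_of_disjoint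
    ((Finset.disjoint_filter_filter disjoint_compl_right)), ← Finset.filter_union,
    Finset.union_compl]
  congr 1
  ext w
  simp

/-- The vertex set of `G` is the union of a clique `K` with `k + 1` vertices, one of which, `w`, has
degree `k`, and a stable set of vertices of degree at most `k`. -/
structure IsSplitAt (G : SimpleGraph V) (K : Finset V) (k : ℕ) (w : V) : Prop where
  card : K.card = k + 1
  clique : ∀ u ∈ K, ∀ v ∈ K, u ≠ v → G.Adj u v
  indep : ∀ u ∉ K, ∀ v ∉ K, ¬ G.Adj u v
  le : ∀ v ∉ K, G.degree v ≤ k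
  mem : w ∈ K
  deg : G.degree w = k

/-- Equality in the Erdős–Gallai inequality forces a split graph. -/
theorem isSplitAt_of_sum {K : Finset V} {k : ℕ} {w : V} (hK : K.card = k + 1)
    (hsum : ∑ v ∈ K, G.degree v = (k + 1) * k + ∑ v ∈ Kᶜ, G.degree v)
    (hle : ∀ v ∉ K, G.degree v ≤ k) (hw : w ∈ K) (hdeg : G.degree w = k) :
    IsSplitAt G K k w := by
  -- After splitting degrees, the edges between `K` and its complement cancel. What is left equates
  -- the degrees inside `K`, at most `(k + 1) * k` in total, with `(k + 1) * k` plus the degrees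
  -- inside the complement, so both bounds are tight.
  simp only [← degIn_add_compl K, Finset.sum_add_distrib] at hsum
  rw [sum_degIn_comm K Kᶜ] at hsum
  have hbound : ∑ v ∈ K, degIn G K v ≤ ∑ _v ∈ K, k :=
    Finset.sum_le_sum fun v hv => degIn_le_of_mem hK hv
  have hc : ∑ _v ∈ K, k = (k + 1) * k := by simp [hK]
  have h0 : ∑ v ∈ Kᶜ, degIn G Kᶜ v = 0 := by omega
  have h1 : ∑ v ∈ K, degIn G K v = ∑ _v ∈ K, k := by omega
  have h2 := (Finset.sum_eq_sum_iff_of_le fun v hv => degIn_le_of_mem (G := G) hK hv).1 h1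
  refine ⟨hK, fun u hu v hv huv => adj_of_degIn_eq hK hu (h2 u hu) hv huv, ?_, hle, hw, hdeg⟩
  intro u hu v hv huv
  have h3 := Finset.sum_eq_zero_iff.1 h0 u (Finset.mem_compl.2 hu)
  rw [degIn, Finset.card_eq_zero, Finset.filter_eq_empty_iff] at h3
  exact h3 (Finset.mem_compl.2 hv) huv

namespace IsSplitAt

variable {K : Finset V} {k : ℕ} {w : V}

/-- The other `k` vertices of the clique already use up the degree of `w`. -/
theorem not_adj (h : IsSplitAt G K k w) {v : V} (hv : v ∉ K) : ¬ G.Adj w v := by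
  intro hwv
  have h1 : K.erase w ⊆ G.neighborFinset w := fun u hu => by
    rw [Finset.mem_erase] at hu
    exact (G.mem_neighborFinset w u).2 (h.clique w h.mem u hu.2 hu.1.symm)
  have h2 := Finset.eq_of_subset_of_card_le h1 (by
    rw [Finset.card_erase_of_mem h.mem, h.card, G.card_neighborFinset_eq_degree, h.deg]
    simp)
  have h3 : v ∈ K.erase w := h2 ▸ (G.mem_neighborFinset w v).2 hwv
  exact hv (Finset.mem_of_mem_erase h3)

theorem exists_not_adj (h : IsSplitAt G K k w) {v : V} (hv : v ∉ K) : ∃ u ∈ K, ¬ G.Adj v u := by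
  by_contra! hc
  have h1 : K ⊆ G.neighborFinset v := fun u hu => (G.mem_neighborFinset v u).2 (hc u hu)
  have h2 := Finset.card_le_card h1
  rw [h.card, G.card_neighborFinset_eq_degree] at h2
  have := h.le v hv
  omega

/-- A vertex outside `K` misses some vertex of `K` and can take its colour; the outside vertices are
mutually non-adjacent, so no conflict arises. -/
theorem chromaticNumber_eq (h : IsSplitAt G K k w) : G.chromaticNumber = (k + 1 : ℕ) := by
  apply le_antisymm
  · choose! g hg hg' using fun v (hv : v ∉ K) => h.exists_not_adj hv
    let c : V → K := fun v => if hv : v ∈ K then ⟨v, hv⟩ else ⟨g v, hg v hv⟩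
    have hc : ∀ {u v}, G.Adj u v → c u ≠ c v := by
      intro u v huv he
      simp only [c] at he
      split_ifs at he with hu hv hv <;> rw [Subtype.mk.injEq] at he
      · exact huv.ne he
      · exact hg' v hv (he ▸ huv.symm)
      · exact hg' u hu (he ▸ huv)
      · exact h.indep u hu v hv huv
    have := (SimpleGraph.Coloring.mk c hc).colorable.chromaticNumber_le
    rwa [Fintype.card_coe, h.card] at this
  · have hcl : G.IsClique K := fun u hu v hv huv => h.clique u hu v hv huv
    rw [← h.card]
    exact hcl.card_le_chromaticNumber

/-- In the complement `K` needs one colour and each other vertex gets its own. This is optimal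
because `w` together with the complement of `K` is stable in `G`. -/
theorem chromaticNumber_compl_eq (h : IsSplitAt G K k w) :
    Gᶜ.chromaticNumber = (Kᶜ.card + 1 : ℕ) := by
  apply le_antisymm
  · let c : V → Option (Kᶜ : Finset V) := fun v =>
      if hv : v ∈ Kᶜ then some ⟨v, hv⟩ else none
    have hc : ∀ {u v}, Gᶜ.Adj u v → c u ≠ c v := by
      intro u v huv he
      rw [SimpleGraph.compl_adj] at huv
      simp only [c] at he
      split_ifs at he with hu hv hv
      · simp only [Option.some.injEq, Subtype.mk.injEq] at he
        exact huv.1 he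
      · rw [Finset.mem_compl, not_not] at hu hv
        exact huv.2 (h.clique u hu v hv huv.1)
    have := (SimpleGraph.Coloring.mk c hc).colorable.chromaticNumber_le
    rwa [Fintype.card_option, Fintype.card_coe] at this
  · have hcl : Gᶜ.IsClique (insert w Kᶜ : Finset V) := by
      intro u hu v hv huv
      rw [SimpleGraph.compl_adj]
      refine ⟨huv, fun ha => ?_⟩
      rw [Finset.mem_coe, Finset.mem_insert, Finset.mem_compl] at hu hv
      rcases hu with rfl | hu
      · rcases hv with rfl | hv
        · exact huv rfl
        · exact h.not_adj hv ha
      · rcases hv with rfl | hv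
        · exact h.not_adj hu ha.symm
        · exact h.indep u hu v hv ha
    have := hcl.card_le_chromaticNumber
    rwa [Finset.card_insert_of_notMem (by simpa using h.mem)] at this

theorem isNG (h : IsSplitAt G K k w) : IsNG G := by
  have h1 := Finset.card_add_card_compl K
  rw [IsNG, h.chromaticNumber_eq, h.chromaticNumber_compl_eq, ← h1, h.card]
  push_cast
  ring

theorem mem_partA (h : IsSplitAt G K k w) (v : V) : v ∈ partA G ↔ G.degree v = k := by
  rw [partA, Set.mem_ofPred_eq, h.chromaticNumber_eq, ← Nat.cast_add_one, Nat.cast_inj]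
  omega

theorem isClique_partA_iff (h : IsSplitAt G K k w) :
    G.IsClique (partA G) ↔ ∀ v ∉ K, G.degree v ≠ k := by
  constructor
  · intro hc v hv hd
    exact h.not_adj hv (hc ((h.mem_partA w).2 h.deg) ((h.mem_partA v).2 hd)
      (fun e => hv (e ▸ h.mem)))
  · intro hd u hu v hv huv
    rw [h.mem_partA] at hu hv
    exact h.clique u (by_contra fun hn => hd u hn hu) v (by_contra fun hn => hd v hn hv) huv

theorem isIndepSet_partA_iff (h : IsSplitAt G K k w) :
    G.IsIndepSet (partA G) ↔ ∀ v ∈ K, v ≠ w → G.degree v ≠ k := by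
  constructor
  · intro hc v hv hne hd
    exact hc ((h.mem_partA v).2 hd) ((h.mem_partA w).2 h.deg) hne (h.clique v hv w h.mem hne)
  · intro hd u hu v hv huv ha
    rw [h.mem_partA] at hu hv
    have key : ∀ v ∈ K, G.degree v = k → v = w := fun v hv hk =>
      by_contra fun hne => hd v hv hne hk
    by_cases huK : u ∈ K
    · have := key u huK hu
      subst this
      by_cases hvK : v ∈ K
      · exact huv (key v hvK hv).symm
      · exact h.not_adj hvK ha
    · by_cases hvK : v ∈ K
      · have := key v hvK hv
        subst this
        exact h.not_adj huK ha.symm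
      · exact h.indep u huK v hvK ha

end IsSplitAt

end Split

/-! ## Blocks whose halves have the same number of parts -/

/-- Double counting of the boxes below the diagonal in the first `k` columns, by columns and by
rows. -/
theorem sum_colBelow (D : ℕ → ℕ) (N k : ℕ) :
    ∑ j ∈ Finset.range k, colBelow D N j = ∑ i ∈ Finset.range N, min k (min i (D i)) := by
  simp only [colBelow, Finset.card_filter]
  rw [Finset.sum_comm]
  refine Finset.sum_congr rfl fun i _ => ?_
  rw [← Finset.card_filter, ← Finset.card_range (min k (min i (D i)))]
  congr 1
  ext j
  simp only [Finset.mem_filter, Finset.mem_range]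
  omega

section Durfee

variable {n m N : ℕ} {x : SBlock n} {D : ℕ → ℕ}
  (hanti : Antitone D) (hzero : ∀ i, N ≤ i → D i = 0)
  (hα : ∀ i, x.α.part i = D i - i) (hβ : ∀ j, x.β.part j = colBelow D N j)
  (hlα : x.α.len = m + 1) (hlβ : x.β.len = m + 1)

include hα hlα in
theorem lt_iff_of_len (i : ℕ) : i < D i ↔ i < m + 1 := by
  have := x.α.part_pos_iff (i := i)
  rw [hα, hlα] at this
  omega

include hanti hα hβ hlα hlβ in
-- The length of `α` gives `D (m + 1) ≤ m + 1`; a box in column `m` below the diagonal lies in a row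
-- of index at least `m + 1`, which gives the reverse inequality.
theorem apply_durfee : D (m + 1) = m + 1 := by
  have h1 := (lt_iff_of_len hα hlα (m + 1)).not.2 (lt_irrefl _)
  have h2 := (x.β.part_pos_iff (i := m)).2 (by omega)
  rw [hβ, colBelow, Finset.card_pos] at h2
  obtain ⟨i, hi⟩ := h2
  rw [Finset.mem_filter] at hi
  have := hanti (show m + 1 ≤ i from hi.2.1)
  omega

include hanti hzero hα hβ hlα hlβ in
theorem durfee_lt : m + 1 < N := by
  have := apply_durfee hanti hα hβ hlα hlβ
  by_contra h
  have := hzero (m + 1) (by omega)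
  omega

include hanti hzero hα hβ hlα hlβ in
-- Equality in the Erdős–Gallai inequality for the `m + 2` largest degrees, obtained by counting
-- both halves as `n` boxes. Rows from `m + 2` on lie wholly below the diagonal; row `i ≤ m + 1` has
-- `i` boxes there.
theorem sum_durfee : ∑ i ∈ Finset.range (m + 2), D i
    = (m + 2) * (m + 1) + ∑ i ∈ Finset.Ico (m + 2) N, D i := by
  have hN := durfee_lt hanti hzero hα hβ hlα hlβ
  have hk := apply_durfee hanti hα hβ hlα hlβ
  have h1 : x.α.psum (m + 1) = n := x.α.psum_of_len_le hlα.le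
  have h2 : x.β.psum (m + 1) = n := x.β.psum_of_len_le hlβ.le
  rw [Dis.psum_eq_sum] at h1 h2
  simp only [hα] at h1
  simp only [hβ] at h2
  rw [sum_colBelow, ← Finset.sum_range_add_sum_Ico _ (show m + 2 ≤ N by omega)] at h2
  have h3 : ∑ i ∈ Finset.Ico (m + 2) N, min (m + 1) (min i (D i))
      = ∑ i ∈ Finset.Ico (m + 2) N, D i := by
    refine Finset.sum_congr rfl fun i hi => ?_
    have := hanti (show m + 1 ≤ i by have := (Finset.mem_Ico.1 hi).1; omega)
    have := (Finset.mem_Ico.1 hi).1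
    omega
  have h4 : ∑ i ∈ Finset.range (m + 2), min (m + 1) (min i (D i))
      = ∑ i ∈ Finset.range (m + 2), i := by
    refine Finset.sum_congr rfl fun i hi => ?_
    rw [Finset.mem_range] at hi
    rcases Nat.lt_or_ge i (m + 1) with h | h
    · have := (lt_iff_of_len hα hlα i).2 h
      omega
    · have : i = m + 1 := by omega
      subst this
      omega
  have h5 : ∑ i ∈ Finset.range (m + 2), D i
      = ∑ i ∈ Finset.range (m + 1), (D i - i) + ∑ i ∈ Finset.range (m + 2), i := by
    rw [Finset.sum_range_succ _ (m + 1), Finset.sum_range_succ _ (m + 1), hk, ← add_assoc (∑ i ∈ Finset.range (m + 1), (D i - i)),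
      ← Finset.sum_add_distrib]
    congr 1
    refine Finset.sum_congr rfl fun i hi => ?_
    have := (lt_iff_of_len hα hlα i).2 (Finset.mem_range.1 hi)
    omega
  have h6 := Finset.sum_range_id_mul_two (m + 2)
  rw [h3, h4] at h2
  rw [show m + 2 - 1 = m + 1 from rfl] at h6
  omega

include hanti hzero hα hβ hlα hlβ in
-- The last column below the diagonal always has a box in row `m + 1`; a second box means that row
-- `m + 2` also has length `m + 1`.
theorem last_part_beta_iff : x.β.part m = 1 ↔ D (m + 2) ≠ m + 1 := by
  have hN := durfee_lt hanti hzero hα hβ hlα hlβ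
  have hk := apply_durfee hanti hα hβ hlα hlβ
  have hle := hanti (Nat.le_succ (m + 1))
  rw [hβ, colBelow]
  have hmem : m + 1 ∈ (Finset.range N).filter fun i => m < i ∧ m < D i := by
    simp only [Finset.mem_filter, Finset.mem_range]
    omega
  constructor
  · intro h hd
    obtain ⟨a, ha⟩ := Finset.card_eq_one.1 h
    have hN' : m + 2 < N := by
      by_contra hc
      have := hzero (m + 2) (by omega)
      omega
    have hmem' : m + 2 ∈ (Finset.range N).filter fun i => m < i ∧ m < D i := by
      simp only [Finset.mem_filter, Finset.mem_range]
      omega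
    rw [ha, Finset.mem_singleton] at hmem hmem'
    omega
  · intro hd
    refine Finset.card_eq_one.2 ⟨m + 1, Finset.eq_singleton_iff_unique_mem.2 ⟨hmem, ?_⟩⟩
    intro i hi
    simp only [Finset.mem_filter, Finset.mem_range] at hi
    by_contra hne
    have := hanti (show m + 2 ≤ i by omega)
    simp only [Nat.succ_eq_add_one] at hle
    have h12 : D (m + 1 + 1) = D (m + 2) := rfl
    omega

include hanti hα hβ hlα hlβ in
theorem last_part_alpha_iff : 2 ≤ x.α.part m ↔ D m ≠ m + 1 := by
  have hk := apply_durfee hanti hα hβ hlα hlβ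
  have hle := hanti (Nat.le_succ m)
  have := (lt_iff_of_len hα hlα m).2 (by omega)
  rw [hα]
  omega

end Durfee

theorem sum_filter_equiv {V : Type*} [Fintype V] {N : ℕ} (f : Fin N ≃ V) (p : ℕ → Prop)
    [DecidablePred p] (g : ℕ → ℕ) :
    ∑ v with p (f.symm v), g (f.symm v) = ∑ i ∈ Finset.range N with p i, g i := by
  rw [Finset.sum_filter, Finset.sum_filter,
    Equiv.sum_comp f.symm fun i => if p i then g i else 0,
    Fin.sum_univ_eq_sum_range fun i => if p i then g i else 0]

/-- A graph whose block has two halves with `m + 1` parts each is an NG-graph, and the last parts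
of the block tell its type. -/
theorem SBlock.IsBlockOf.isNG {V : Type*} [Fintype V] {G : SimpleGraph V} {n m : ℕ}
    {x : SBlock n} (h : x.IsBlockOf G) (hlα : x.α.len = m + 1) (hlβ : x.β.len = m + 1) :
    IsNG G ∧ (G.IsClique (partA G) ↔ x.β.part m = 1) ∧
      (G.IsIndepSet (partA G) ↔ 2 ≤ x.α.part m) := by
  classical
  obtain ⟨f, D, hD⟩ := exists_isDegFun G
  obtain ⟨hα, hβ⟩ := (hD.isBlockOf_iff x).1 h
  have hN := durfee_lt hD.anti hD.zero hα hβ hlα hlβ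
  have hk := apply_durfee hD.anti hα hβ hlα hlβ
  have hsum := sum_durfee hD.anti hD.zero hα hβ hlα hlβ
  have hdeg : ∀ v, G.degree v = D (f.symm v) := fun v => by
    have := hD.deg (f.symm v)
    rwa [f.apply_symm_apply] at this
  -- The clique consists of the `m + 2` vertices of largest degree; the last of these has degree `m
  -- + 1` and plays the role of `w`.
  let K : Finset V := Finset.univ.filter fun v => (f.symm v : ℕ) < m + 2
  have hmem : ∀ v, v ∈ K ↔ (f.symm v : ℕ) < m + 2 := fun v => by simp [K]
  have hKc : Kᶜ = Finset.univ.filter fun v => ¬ (f.symm v : ℕ) < m + 2 := by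
    ext v; simp [K]
  have hf1 : (Finset.range (Fintype.card V)).filter (fun i => i < m + 2) = Finset.range (m + 2) := by
    ext i
    simp only [Finset.mem_filter, Finset.mem_range]
    omega
  have hf2 : (Finset.range (Fintype.card V)).filter (fun i => ¬ i < m + 2)
      = Finset.Ico (m + 2) (Fintype.card V) := by
    ext i
    simp only [Finset.mem_filter, Finset.mem_range, Finset.mem_Ico]
    omega
  have hsplit : IsSplitAt G K (m + 1) (f ⟨m + 1, hN⟩) := by
    apply isSplitAt_of_sum
    · rw [Finset.card_eq_sum_ones, sum_filter_equiv f (fun i => i < m + 2) fun _ => 1, hf1]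
      simp
    · rw [hKc]
      have h1 := sum_filter_equiv f (fun i => i < m + 2) D
      have h2 := sum_filter_equiv f (fun i => ¬ i < m + 2) D
      rw [hf1] at h1
      rw [hf2] at h2
      rw [← h1, ← h2] at hsum
      simpa only [hdeg] using hsum
    · intro v hv
      rw [hmem] at hv
      have := hD.anti (show m + 1 ≤ f.symm v by omega)
      rwa [hk, ← hdeg] at this
    · simp [hmem]
    · have := hdeg (f ⟨m + 1, hN⟩)
      rw [f.symm_apply_apply, hk] at this
      exact this
  refine ⟨hsplit.isNG, ?_, ?_⟩
  · rw [hsplit.isClique_partA_iff, last_part_beta_iff hD.anti hD.zero hα hβ hlα hlβ]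
    constructor
    · intro hv hd
      have hN' : m + 2 < Fintype.card V := by
        by_contra hc
        have := hD.zero (m + 2) (by omega)
        omega
      refine hv (f ⟨m + 2, hN'⟩) (by simp [hmem]) ?_
      have := hdeg (f ⟨m + 2, hN'⟩)
      rw [f.symm_apply_apply, hd] at this
      exact this
    · intro hd v hv hv'
      rw [hmem] at hv
      have h1 := hD.anti (show m + 2 ≤ f.symm v by omega)
      have h2 := hD.anti (show m + 1 ≤ m + 2 by omega)
      rw [← hdeg] at h1
      omega
  · rw [hsplit.isIndepSet_partA_iff, last_part_alpha_iff hD.anti hα hβ hlα hlβ]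
    constructor
    · intro hv hd
      refine hv (f ⟨m, by omega⟩) (by simp [hmem]) (fun e => ?_) ?_
      · have := f.injective e
        simp at this
      · have := hdeg (f ⟨m, by omega⟩)
        rw [f.symm_apply_apply, hd] at this
        exact this
    · intro hd v hv hne hv'
      rw [hmem] at hv
      have h3 : D (f.symm v) = m + 1 := (hdeg v).symm.trans hv'
      have h4 : (f.symm v : ℕ) ≠ m + 1 := by
        intro e
        apply hne
        rw [← f.apply_symm_apply v]
        congr 1
        exact Fin.ext e
      have h1 := hD.anti (show (f.symm v : ℕ) ≤ m by omega)
      have h5 := (lt_iff_of_len hα hlα m).2 (by omega)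
      omega

/-! ## The Gale–Ryser theorem -/

/-- Column sums of the 0-1 matrix with rows in `S` whose ones in row `i` are in the columns
`R i`. -/
def colSum (S : Finset ℕ) (R : ℕ → Finset ℕ) (j : ℕ) : ℕ := (S.filter fun i => j ∈ R i).card

/-- Column `p` has more ones than column `q`, so some row has a one in `p` and none in `q`; that one
is moved. -/
theorem exists_shift {S : Finset ℕ} {R : ℕ → Finset ℕ} {p q k : ℕ} (hpq : p ≠ q) (hq : q < k)
    (hR : ∀ i ∈ S, R i ⊆ Finset.range k) (h : colSum S R q < colSum S R p) :
    ∃ R' : ℕ → Finset ℕ, (∀ i ∈ S, R' i ⊆ Finset.range k ∧ (R' i).card = (R i).card) ∧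
      ∀ j, colSum S R' j + (if j = p then 1 else 0) = colSum S R j + if j = q then 1 else 0 := by
  obtain ⟨i, hiS, hip, hiq⟩ : ∃ i ∈ S, p ∈ R i ∧ q ∉ R i := by
    by_contra! hc
    refine h.not_ge (Finset.card_le_card fun i hi => ?_)
    rw [Finset.mem_filter] at hi ⊢
    exact ⟨hi.1, hc i hi.1 hi.2⟩
  refine ⟨Function.update R i (insert q ((R i).erase p)), fun l hl => ?_, fun j => ?_⟩
  · by_cases hli : l = i
    · subst hli
      rw [Function.update_self]
      refine ⟨?_, ?_⟩
      · intro j hj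
        rw [Finset.mem_insert] at hj
        rcases hj with rfl | hj
        · exact Finset.mem_range.2 hq
        · exact hR l hl (Finset.mem_of_mem_erase hj)
      · rw [Finset.card_insert_of_notMem (fun h => hiq (Finset.mem_of_mem_erase h)),
          Finset.card_erase_of_mem hip]
        have := Finset.card_pos.2 ⟨p, hip⟩
        omega
    · rw [Function.update_of_ne hli]
      exact ⟨hR l hl, rfl⟩
  · have hsplit : ∀ R : ℕ → Finset ℕ,
        colSum S R j = (if j ∈ R i then 1 else 0) + colSum (S.erase i) R j := by
      intro R
      simp only [colSum, Finset.card_filter]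
      rw [Finset.add_sum_erase S (fun i => if j ∈ R i then 1 else 0) hiS]
    have hrest : colSum (S.erase i) (Function.update R i (insert q ((R i).erase p))) j
        = colSum (S.erase i) R j := by
      unfold colSum
      congr 1
      refine Finset.filter_congr fun l hl => ?_
      rw [Function.update_of_ne (Finset.ne_of_mem_erase hl)]
    rw [hsplit, hsplit R, hrest, Function.update_self]
    simp only [Finset.mem_insert, Finset.mem_erase]
    by_cases hjp : j = p
    · subst hjp
      simp [hpq, hip, add_comm]
    · by_cases hjq : j = q
      · subst hjq
        simp [hjp, hiq, add_comm]
      · simp [hjp, hjq]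

/-- A 0-1 matrix whose column sums majorize the non-increasing sequence `c` can be changed, with
the same row sums, into one whose column sums are `c`. -/
theorem exists_colSum_eq (S : Finset ℕ) (k : ℕ) (c : ℕ → ℕ)
    (hc : ∀ i j, i ≤ j → j < k → c j ≤ c i) (R : ℕ → Finset ℕ)
    (hR : ∀ i ∈ S, R i ⊆ Finset.range k)
    (hle : ∀ t ≤ k, ∑ j ∈ Finset.range t, c j ≤ ∑ j ∈ Finset.range t, colSum S R j)
    (heq : ∑ j ∈ Finset.range k, c j = ∑ j ∈ Finset.range k, colSum S R j) :
    ∃ R' : ℕ → Finset ℕ, (∀ i ∈ S, R' i ⊆ Finset.range k ∧ (R' i).card = (R i).card) ∧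
      ∀ j < k, colSum S R' j = c j := by
  -- Each shift of a one to the right lowers this total of the partial sums.
  induction hμ : ∑ t ∈ Finset.range (k + 1), ∑ j ∈ Finset.range t, colSum S R j
    using Nat.strong_induction_on generalizing R with
  | _ μ ih =>
    by_cases hall : ∀ t ≤ k, ∑ j ∈ Finset.range t, c j = ∑ j ∈ Finset.range t, colSum S R j
    · refine ⟨R, fun i hi => ⟨hR i hi, rfl⟩, fun j hj => ?_⟩
      have h1 := hall (j + 1) hj
      have h2 := hall j hj.le
      rw [Finset.sum_range_succ, Finset.sum_range_succ] at h1
      omega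
    · push Not at hall
      classical
      let P : ℕ → ℕ := fun t => ∑ j ∈ Finset.range t, colSum S R j
      let Q : ℕ → ℕ := fun t => ∑ j ∈ Finset.range t, c j
      have hP : ∀ t, P (t + 1) = P t + colSum S R t := fun t => Finset.sum_range_succ _ _
      have hQ : ∀ t, Q (t + 1) = Q t + c t := fun t => Finset.sum_range_succ _ _
      have hex : ∃ t, t ≤ k ∧ Q t ≠ P t := hall
      -- The partial sums agree at `p`, differ strictly from `p + 1` to `q`, and agree again at `q +
      -- 1`. So column `p` is too large and column `q` too small, and a shift from `p` to `q` lowers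
      -- exactly the sums that have slack.
      obtain ⟨p, hp⟩ : ∃ p, Nat.find hex = p + 1 := by
        refine ⟨Nat.find hex - 1, ?_⟩
        have : Nat.find hex ≠ 0 := fun h => by
          have := (Nat.find_spec hex).2
          rw [h] at this
          exact this rfl
        omega
      have hp1 := Nat.find_spec hex
      have hp2 : Q p = P p := by
        by_contra h
        exact Nat.find_min hex (m := p) (by omega) ⟨by omega, h⟩
      rw [hp] at hp1
      have hex' : ∃ t, p < t ∧ t ≤ k ∧ Q t = P t := ⟨k, by omega, le_rfl, heq⟩
      obtain ⟨q, hq⟩ : ∃ q, Nat.find hex' = q + 1 :=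
        ⟨Nat.find hex' - 1, by have := (Nat.find_spec hex').1; omega⟩
      have hq1 := Nat.find_spec hex'
      have hq2 : ∀ t, p < t → t ≤ q → Q t < P t := by
        intro t h1 h2
        refine lt_of_le_of_ne (hle t (by omega)) fun h => ?_
        exact Nat.find_min hex' (m := t) (by omega) ⟨h1, by omega, h⟩
      rw [hq] at hq1
      have hpq : p < q := by
        have : p ≠ q := by rintro rfl; exact hp1.2 hq1.2.2
        omega
      have e1 : c p < colSum S R p := by
        have h1 := hq2 (p + 1) (by omega) (by omega)
        have := hP p
        have := hQ p
        omega
      have e2 : colSum S R q < c q := by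
        have h1 := hq2 q hpq le_rfl
        have := hP q
        have := hQ q
        omega
      have e3 := hc p q hpq.le (by omega)
      obtain ⟨R₁, hR₁, hcol⟩ := exists_shift hpq.ne (by omega) hR (by omega)
      have hP₁ : ∀ t, (∑ j ∈ Finset.range t, colSum S R₁ j) + (if p < t ∧ t ≤ q then 1 else 0)
          = P t := by
        intro t
        induction t with
        | zero => simp [P]
        | succ t iht =>
          rw [Finset.sum_range_succ, hP, ← iht]
          have := hcol t
          split_ifs at this ⊢ <;> omega
      obtain ⟨R', h1, h2⟩ := ih (∑ t ∈ Finset.range (k + 1), ∑ j ∈ Finset.range t, colSum S R₁ j)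
        (by
          rw [← hμ]
          apply Finset.sum_lt_sum
          · intro t _
            exact (Nat.le_add_right _ _).trans (hP₁ t).le
          · refine ⟨p + 1, Finset.mem_range.2 (by omega), ?_⟩
            have := hP₁ (p + 1)
            rw [if_pos (by omega)] at this
            change _ < P (p + 1)
            omega)
        R₁ (fun i hi => (hR₁ i hi).1)
        (by
          intro t ht
          have h1 := hP₁ t
          have h2 : Q t ≤ P t := hle t ht
          change Q t ≤ _
          split_ifs at h1 with h
          · have := hq2 t h.1 h.2
            omega
          · omega)
        (by
          have h1 := hP₁ k
          rw [if_neg (by omega)] at h1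
          change Q k = _
          have : Q k = P k := heq
          omega)
        rfl
      exact ⟨R', fun i hi => ⟨(h1 i hi).1, (h1 i hi).2.trans (hR₁ i hi).2⟩, h2⟩

/-! ## Realizing blocks by split graphs -/

/-- Distinctness of the parts makes `part i + i` non-increasing up to `len`, where the part is 0. -/
theorem Dis.part_add_le {n : ℕ} (γ : Dis n) {i j : ℕ} (hij : i ≤ j) (hj : j ≤ γ.len) :
    γ.part j + j ≤ γ.part i + i := by
  induction j, hij using Nat.le_induction with
  | base => rfl
  | succ j hij ih =>
    have := γ.part_succ_lt (i := j) (by omega)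
    have := ih (by omega)
    omega

theorem Dis.len_le_part_add {n : ℕ} (γ : Dis n) {i : ℕ} (hi : i ≤ γ.len) :
    γ.len ≤ γ.part i + i :=
  le_trans (by omega) (γ.part_add_le hi le_rfl)

open Classical in
theorem degree_fin {N : ℕ} (G : SimpleGraph (Fin N)) (u : Fin N) (T : Finset ℕ)
    (hT : ∀ v ∈ T, v < N) (hG : ∀ v : Fin N, G.Adj u v ↔ (v : ℕ) ∈ T) : G.degree u = T.card := by
  rw [← G.card_neighborFinset_eq_degree, ← Finset.card_map Fin.valEmbedding]
  congr 1
  ext v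
  simp only [Finset.mem_map, SimpleGraph.mem_neighborFinset, hG, Fin.valEmbedding_apply]
  exact ⟨fun ⟨w, h, e⟩ => e ▸ h, fun h => ⟨⟨v, hT v h⟩, h, rfl⟩⟩

/-- The degree sequence with upper half `a` and lower half `b`, if the Durfee square has side
`k`. -/
def degOf (k : ℕ) (a b : ℕ → ℕ) (i : ℕ) : ℕ :=
  if i < k then a i + i else ((Finset.range k).filter fun j => i ≤ j + b j).card

theorem degOf_le (k : ℕ) (a b : ℕ → ℕ) {i : ℕ} (hi : k ≤ i) : degOf k a b i ≤ k := by
  rw [degOf, if_neg (by omega)]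
  exact (Finset.card_filter_le _ _).trans (Finset.card_range k).le

namespace SBlock

variable {n m : ℕ} (x : SBlock n) (hlα : x.α.len = m + 1) (hlβ : x.β.len = m + 1)

include hlα in
theorem degOf_antitone : Antitone (degOf (m + 1) x.α.part x.β.part) := by
  intro i j hij
  by_cases hj : j < m + 1
  · rw [degOf, degOf, if_pos hj, if_pos (by omega)]
    exact x.α.part_add_le hij (by omega)
  · by_cases hi : i < m + 1
    · refine (degOf_le _ _ _ (not_lt.1 hj)).trans ?_
      rw [degOf, if_pos hi]
      have := x.α.len_le_part_add (i := i) (by omega)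
      omega
    · rw [degOf, degOf, if_neg hj, if_neg hi]
      apply Finset.card_le_card
      intro l
      simp only [Finset.mem_filter]
      rintro ⟨h1, h2⟩
      exact ⟨h1, by omega⟩

include hlβ in
theorem degOf_eq_zero (i : ℕ) (hi : x.β.part 0 + 1 ≤ i) :
    degOf (m + 1) x.α.part x.β.part i = 0 := by
  have h0 := x.β.len_le_part_add (i := 0) (by omega)
  rw [degOf, if_neg (by omega), Finset.card_eq_zero, Finset.filter_eq_empty_iff]
  intro j hj
  rw [Finset.mem_range] at hj
  have := x.β.part_add_le (Nat.zero_le j) (by omega)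
  omega

include hlα in
theorem part_alpha_eq (i : ℕ) : x.α.part i = degOf (m + 1) x.α.part x.β.part i - i := by
  by_cases hi : i < m + 1
  · rw [degOf, if_pos hi]; omega
  · have h1 := degOf_le (m + 1) x.α.part x.β.part (not_lt.1 hi)
    have h2 := x.α.part_pos_iff (i := i)
    omega

include hlβ in
-- Since `j + β j` is non-increasing, the columns counted by `degOf` form an initial segment.
theorem lt_degOf_iff {i j : ℕ} (hj : j < m + 1) (hi : m + 1 ≤ i) :
    j < degOf (m + 1) x.α.part x.β.part i ↔ i ≤ j + x.β.part j := by
  rw [degOf, if_neg (by omega)]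
  constructor
  · intro h
    by_contra hc
    have : ((Finset.range (m + 1)).filter fun j => i ≤ j + x.β.part j) ⊆ Finset.range j := by
      intro l
      simp only [Finset.mem_filter, Finset.mem_range]
      rintro ⟨h1, h2⟩
      by_contra hl
      have := x.β.part_add_le (not_lt.1 hl) (by omega)
      omega
    have := Finset.card_le_card this
    rw [Finset.card_range] at this
    omega
  · intro h
    have : Finset.range (j + 1) ⊆ (Finset.range (m + 1)).filter fun j => i ≤ j + x.β.part j := by
      intro l
      simp only [Finset.mem_filter, Finset.mem_range]
      intro hl
      have := x.β.part_add_le (show l ≤ j by omega) (by omega)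
      omega
    have := Finset.card_le_card this
    rw [Finset.card_range] at this
    omega

include hlα hlβ in
theorem part_beta_eq (j : ℕ) :
    x.β.part j = colBelow (degOf (m + 1) x.α.part x.β.part) (x.β.part 0 + 1) j := by
  by_cases hj : j < m + 1
  · have hset : ((Finset.range (x.β.part 0 + 1)).filter
        fun i => j < i ∧ j < degOf (m + 1) x.α.part x.β.part i)
        = Finset.Ioc j (j + x.β.part j) := by
      ext i
      simp only [Finset.mem_filter, Finset.mem_range, Finset.mem_Ioc]
      have h0 := x.β.part_add_le (Nat.zero_le j) (by omega)
      have h1 := x.β.len_le_part_add (i := j) (by omega)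
      by_cases hi : i < m + 1
      · have h2 := x.α.len_le_part_add (i := i) (by omega)
        rw [degOf, if_pos hi]
        omega
      · rw [lt_degOf_iff x hlβ hj (not_lt.1 hi)]
        omega
    rw [colBelow, hset, Nat.card_Ioc]
    omega
  · have h1 := x.β.part_pos_iff (i := j)
    have h2 : x.β.part j = 0 := by omega
    rw [h2, eq_comm, colBelow, Finset.card_eq_zero, Finset.filter_eq_empty_iff]
    intro i _ hi
    have := degOf_le (m + 1) x.α.part x.β.part (show m + 1 ≤ i by omega)
    omega

/-- The subtraction is never truncated because `part j + j ≥ k`. Thus majorization of partitions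
carries over to the shifted column sums. -/
theorem sum_part_add_sub {n k : ℕ} {γ : Dis n} (hk : γ.len = k) {t : ℕ} (ht : t ≤ k) :
    ∑ j ∈ Finset.range t, (γ.part j + j - k) + t * k
      = γ.psum t + ∑ j ∈ Finset.range t, j := by
  induction t with
  | zero => simp [Dis.psum_zero]
  | succ t ih =>
    have h1 := ih (by omega)
    have h2 := γ.len_le_part_add (i := t) (by omega)
    rw [Finset.sum_range_succ, Finset.sum_range_succ, Dis.psum_succ, Nat.succ_mul]
    omega

include hlα hlβ in
/-- A 0-1 matrix with the adjacencies between the clique and the stable set of a split graph that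
realizes the block. -/
theorem exists_matrix : ∃ R : ℕ → Finset ℕ,
    (∀ i ∈ Finset.Ico (m + 2) (x.β.part 0 + 1), R i ⊆ Finset.range (m + 1) ∧
      (R i).card = degOf (m + 1) x.α.part x.β.part i) ∧
    ∀ j < m + 1, colSum (Finset.Ico (m + 2) (x.β.part 0 + 1)) R j
      = x.α.part j + j - (m + 1) := by
  -- The Ferrers matrix of the rows from `m + 2` on. Its column sums come from `β`, and `α ≤ β` lets
  -- them be changed to those required by `α`. Row `m + 1` is left out because it belongs to the
  -- clique vertex with no neighbours outside.
  let R₀ : ℕ → Finset ℕ := fun i => (Finset.range (m + 1)).filter fun j => i ≤ j + x.β.part j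
  have hcol : ∀ j < m + 1, colSum (Finset.Ico (m + 2) (x.β.part 0 + 1)) R₀ j
      = x.β.part j + j - (m + 1) := by
    intro j hj
    have : ((Finset.Ico (m + 2) (x.β.part 0 + 1)).filter fun i => j ∈ R₀ i)
        = Finset.Ioc (m + 1) (x.β.part j + j) := by
      ext i
      have := x.β.part_add_le (Nat.zero_le j) (by omega)
      simp only [R₀, Finset.mem_filter, Finset.mem_range, Finset.mem_Ico, Finset.mem_Ioc]
      omega
    rw [colSum, this, Nat.card_Ioc]
  have hsum : ∀ t ≤ m + 1,
      ∑ j ∈ Finset.range t, colSum (Finset.Ico (m + 2) (x.β.part 0 + 1)) R₀ j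
      = ∑ j ∈ Finset.range t, (x.β.part j + j - (m + 1)) := fun t ht =>
    Finset.sum_congr rfl fun j hj => hcol j (by rw [Finset.mem_range] at hj; omega)
  obtain ⟨R, h1, h2⟩ := exists_colSum_eq (Finset.Ico (m + 2) (x.β.part 0 + 1)) (m + 1)
    (fun j => x.α.part j + j - (m + 1))
    (fun i j hij hj => by
      have := x.α.part_add_le hij (by omega)
      omega)
    R₀ (fun i _ => Finset.filter_subset _ _)
    (fun t ht => by
      rw [hsum t ht]
      have e1 := sum_part_add_sub hlα ht
      have e2 := sum_part_add_sub hlβ ht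
      have e3 := Dis.le_iff.1 x.maj t
      omega)
    (by
      rw [hsum _ le_rfl]
      have e1 := sum_part_add_sub hlα le_rfl
      have e2 := sum_part_add_sub hlβ le_rfl
      have e3 := x.α.psum_of_len_le hlα.le
      have e4 := x.β.psum_of_len_le hlβ.le
      omega)
  refine ⟨R, fun i hi => ⟨(h1 i hi).1, (h1 i hi).2.trans ?_⟩, h2⟩
  rw [Finset.mem_Ico] at hi
  rw [degOf, if_neg (by omega)]

include hlα hlβ in
/-- Every block whose two halves have the same number of parts is the block of a graph. -/
theorem exists_isBlockOf : ∃ (N : ℕ) (G : SimpleGraph (Fin N)), x.IsBlockOf G := by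
  classical
  obtain ⟨R, hR, hcol⟩ := x.exists_matrix hlα hlβ
  have hN : m + 1 < x.β.part 0 + 1 := by
    have := x.β.len_le_part_add (i := 0) (by omega)
    omega
  -- Vertices `0, …, m + 1` form a clique, the others a stable set, and the rows of `R` give the
  -- edges between. Degrees are checked separately for `u ≤ m`, for `m + 1`, and for the stable set.
  let A : ℕ → ℕ → Prop := fun u v => u ≠ v ∧
    ((u < m + 2 ∧ v < m + 2) ∨ (m + 2 ≤ u ∧ v ∈ R u) ∨ (m + 2 ≤ v ∧ u ∈ R v))
  let G : SimpleGraph (Fin (x.β.part 0 + 1)) :=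
    { Adj := fun u v => A u v
      symm := ⟨fun u v h => ⟨h.1.symm, by tauto⟩⟩
      loopless := ⟨fun u h => h.1 rfl⟩ }
  refine ⟨_, G, ((IsDegFun.isBlockOf_iff (f := Equiv.refl _)
    (D := degOf (m + 1) x.α.part x.β.part) ⟨x.degOf_antitone hlα, fun u => ?_,
      x.degOf_eq_zero hlβ⟩) x).2 ⟨x.part_alpha_eq hlα, x.part_beta_eq hlα hlβ⟩⟩
  rw [Equiv.refl_apply]
  have hRlt : ∀ u v, m + 2 ≤ u → u < x.β.part 0 + 1 → v ∈ R u → v < m + 1 := fun u v h1 h2 h =>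
    Finset.mem_range.1 ((hR u (Finset.mem_Ico.2 ⟨h1, h2⟩)).1 h)
  rcases lt_trichotomy (u : ℕ) (m + 1) with hu | hu | hu
  · have hdisj : Disjoint ((Finset.range (m + 2)).erase u)
        ((Finset.Ico (m + 2) (x.β.part 0 + 1)).filter fun i => (u : ℕ) ∈ R i) := by
      rw [Finset.disjoint_left]
      intro v hv hv'
      rw [Finset.mem_erase, Finset.mem_range] at hv
      rw [Finset.mem_filter, Finset.mem_Ico] at hv'
      omega
    have hset := degree_fin G u ((Finset.range (m + 2)).erase u ∪
        (Finset.Ico (m + 2) (x.β.part 0 + 1)).filter fun i => (u : ℕ) ∈ R i)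
      (fun v => by
        simp only [Finset.mem_union, Finset.mem_erase, Finset.mem_range, Finset.mem_filter,
          Finset.mem_Ico]
        omega)
      (fun v => by
        simp only [Finset.mem_filter, Finset.mem_range, Finset.mem_union, Finset.mem_erase,
          Finset.mem_Ico]
        constructor
        · rintro ⟨h2, ⟨h3, h4⟩ | ⟨h3, h4⟩ | ⟨h3, h4⟩⟩
          · exact Or.inl ⟨h2.symm, h4⟩
          · omega
          · exact Or.inr ⟨⟨h3, v.isLt⟩, h4⟩
        · rintro (⟨h1, h2⟩ | ⟨⟨h1, h2⟩, h3⟩)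
          · exact ⟨h1.symm, Or.inl ⟨by omega, h2⟩⟩
          · exact ⟨by omega, Or.inr (Or.inr ⟨h1, h3⟩)⟩)
    have h1 := hcol u hu
    rw [colSum] at h1
    have h2 := x.α.len_le_part_add (i := u) (by omega)
    rw [hset, Finset.card_union_of_disjoint hdisj, h1,
      Finset.card_erase_of_mem (Finset.mem_range.2 (by omega)), Finset.card_range, degOf,
      if_pos hu]
    omega
  · have hset := degree_fin G u (Finset.range (m + 1))
      (fun v hv => by rw [Finset.mem_range] at hv; omega)
      (fun v => by
        rw [Finset.mem_range]
        constructor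
        · rintro ⟨h2, ⟨h3, h4⟩ | ⟨h3, h4⟩ | ⟨h3, h4⟩⟩
          · omega
          · omega
          · have := hRlt v u h3 v.isLt h4
            omega
        · intro h
          exact ⟨by omega, Or.inl ⟨by omega, by omega⟩⟩)
    rw [hset, Finset.card_range, degOf, if_neg (by omega), Finset.filter_true_of_mem,
      Finset.card_range]
    intro j hj
    rw [Finset.mem_range] at hj
    have := x.β.len_le_part_add (i := j) (by omega)
    omega
  · have hset := degree_fin G u (R u)
      (fun v hv => by have := hRlt u v hu u.isLt hv; omega)
      (fun v => by
        constructor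
        · rintro ⟨h2, ⟨h3, h4⟩ | ⟨h3, h4⟩ | ⟨h3, h4⟩⟩
          · omega
          · exact h4
          · have := hRlt v u h3 v.isLt h4
            omega
        · intro h
          have := hRlt u v hu u.isLt h
          exact ⟨by omega, Or.inr (Or.inl ⟨hu, h⟩)⟩)
    rw [hset]
    exact (hR u (Finset.mem_Ico.2 ⟨hu, u.isLt⟩)).2

end SBlock

/-! ## Meets and joins of blocks -/

namespace Dis

variable {n : ℕ}

theorem exists_isGLB_pair (γ δ : Dis n) :
    ∃ g, IsGLB {γ, δ} g ∧ ∀ i, g.psum i = min (γ.psum i) (δ.psum i) := by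
  obtain ⟨g, hg, hp⟩ := exists_isGLB (S := {γ, δ}) ⟨γ, by simp⟩
  refine ⟨g, hg, fun i => le_antisymm (le_min ?_ ?_) ?_⟩
  · exact le_iff.1 (hg.1 (by simp)) i
  · exact le_iff.1 (hg.1 (by simp)) i
  · obtain ⟨ε, hε, e⟩ := hp i
    rw [e]
    rcases hε with rfl | rfl
    · exact min_le_left _ _
    · exact min_le_right _ _

/-- The supremum is the infimum of the upper bounds. The explicit bound with `e = 1` shows that
there are some and keeps the length; with `e = 2` it keeps the last part at least 2. -/
theorem exists_isLUB_pair {m : ℕ} {γ δ : Dis n} (hγ : γ.len = m + 1) (hδ : δ.len = m + 1) :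
    ∃ g, IsLUB {γ, δ} g ∧ g.len = m + 1 ∧ γ.psum m ≤ g.psum m ∧ δ.psum m ≤ g.psum m ∧
      (γ.psum m + 2 ≤ n → δ.psum m + 2 ≤ n → g.psum m + 2 ≤ n) := by
  rw [len_eq_iff] at hγ hδ
  have key : ∀ e, 0 < e → γ.psum m + e ≤ n → δ.psum m + e ≤ n →
      ∃ u ∈ upperBounds {γ, δ}, u.psum m + e ≤ n := by
    intro e he h1 h2
    obtain ⟨u, hu, -, hub⟩ := exists_upperBound he γ h1 hγ.2
    refine ⟨u, ?_, hu⟩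
    rintro ε (rfl | rfl)
    · exact hub _ h1 hγ.2
    · exact hub _ h2 hδ.2
  obtain ⟨u, hu, hu'⟩ := key 1 one_pos hγ.1 hδ.1
  obtain ⟨g, hg, -⟩ := exists_isGLB ⟨u, hu⟩
  have hlub := isGLB_upperBounds.1 hg
  have h1 := le_iff.1 (hlub.1 (show γ ∈ ({γ, δ} : Set (Dis n)) by simp))
  have h2 := le_iff.1 (hlub.1 (show δ ∈ ({γ, δ} : Set (Dis n)) by simp))
  refine ⟨g, hlub, ?_, h1 m, h2 m, fun e1 e2 => ?_⟩
  · rw [len_eq_iff]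
    have h3 := le_iff.1 (hg.1 hu) m
    have h4 := h1 (m + 1)
    have h5 := g.psum_le (m + 1)
    omega
  · obtain ⟨v, hv, hv'⟩ := key 2 two_pos e1 e2
    have := le_iff.1 (hg.1 hv) m
    omega

end Dis

namespace SBlock

variable {n : ℕ}

theorem toExt_le_toExt {x y : SBlock n} : x.toExt ≤ y.toExt ↔ x ≤ y :=
  WithBot.coe_le_coe.trans WithTop.coe_le_coe

theorem toExt_ne_top (x : SBlock n) : x.toExt ≠ ⊤ := fun h =>
  WithTop.coe_ne_top (WithBot.coe_injective h)

theorem not_top_le (x : SBlock n) : ¬ (⊤ : ExtSBlock n) ≤ x.toExt := fun h =>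
  x.toExt_ne_top (top_le_iff.1 h)

theorem not_le_bot (x : SBlock n) : ¬ x.toExt ≤ (⊥ : ExtSBlock n) := fun h =>
  WithBot.coe_ne_bot (le_bot_iff.1 h)

theorem ext_cases (w : ExtSBlock n) : w = ⊥ ∨ w = ⊤ ∨ ∃ z : SBlock n, w = z.toExt := by
  rcases w with _ | _ | z
  exacts [Or.inl rfl, Or.inr (Or.inl rfl), Or.inr (Or.inr ⟨z, rfl⟩)]

theorem isGLB_toExt {x y z : SBlock n} (hα : IsGLB {x.α, y.α} z.α)
    (hβ : IsLUB {x.β, y.β} z.β) : IsGLB {x.toExt, y.toExt} z.toExt := by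
  constructor
  · rintro w (rfl | rfl)
    · exact toExt_le_toExt.2 ⟨hα.1 (by simp), hβ.1 (by simp)⟩
    · exact toExt_le_toExt.2 ⟨hα.1 (by simp), hβ.1 (by simp)⟩
  · intro w hw
    have hx := hw (show x.toExt ∈ ({x.toExt, y.toExt} : Set _) by simp)
    have hy := hw (show y.toExt ∈ ({x.toExt, y.toExt} : Set _) by simp)
    rcases ext_cases w with rfl | rfl | ⟨u, rfl⟩
    · exact bot_le
    · exact (x.not_top_le hx).elim
    · rw [toExt_le_toExt] at hx hy ⊢
      refine ⟨hα.2 ?_, hβ.2 ?_⟩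
      · rintro ε (rfl | rfl)
        exacts [hx.1, hy.1]
      · rintro ε (rfl | rfl)
        exacts [hx.2, hy.2]

theorem isLUB_toExt {x y z : SBlock n} (hα : IsLUB {x.α, y.α} z.α)
    (hβ : IsGLB {x.β, y.β} z.β) : IsLUB {x.toExt, y.toExt} z.toExt := by
  constructor
  · rintro w (rfl | rfl)
    · exact toExt_le_toExt.2 ⟨hα.1 (by simp), hβ.1 (by simp)⟩
    · exact toExt_le_toExt.2 ⟨hα.1 (by simp), hβ.1 (by simp)⟩
  · intro w hw
    have hx := hw (show x.toExt ∈ ({x.toExt, y.toExt} : Set _) by simp)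
    have hy := hw (show y.toExt ∈ ({x.toExt, y.toExt} : Set _) by simp)
    rcases ext_cases w with rfl | rfl | ⟨u, rfl⟩
    · exact (x.not_le_bot hx).elim
    · exact le_top
    · rw [toExt_le_toExt] at hx hy ⊢
      refine ⟨hα.2 ?_, hβ.2 ?_⟩
      · rintro ε (rfl | rfl)
        exacts [hx.1, hy.1]
      · rintro ε (rfl | rfl)
        exacts [hx.2, hy.2]

theorem isLUB_top {x y : SBlock n} {a b : Dis n} (hα : IsLUB {x.α, y.α} a)
    (hβ : IsGLB {x.β, y.β} b) (hab : ¬ a ≤ b) : IsLUB {x.toExt, y.toExt} ⊤ := by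
  refine ⟨fun _ _ => le_top, fun w hw => ?_⟩
  have hx := hw (show x.toExt ∈ ({x.toExt, y.toExt} : Set _) by simp)
  have hy := hw (show y.toExt ∈ ({x.toExt, y.toExt} : Set _) by simp)
  rcases ext_cases w with rfl | rfl | ⟨u, rfl⟩
  · exact (x.not_le_bot hx).elim
  · exact le_rfl
  · rw [toExt_le_toExt] at hx hy
    -- A block `u` above both would give `a ≤ u.α ≤ u.β ≤ b`.
    refine (hab (le_trans (hα.2 ?_) (u.maj.trans (hβ.2 ?_)))).elim
    · rintro ε (rfl | rfl)
      exacts [hx.1, hy.1]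
    · rintro ε (rfl | rfl)
      exacts [hx.2, hy.2]

/-- The meet of two blocks of an amphora. -/
theorem exists_meet {m : ℕ} {x y : SBlock n} (hx : x ∈ amphora n (m + 1))
    (hy : y ∈ amphora n (m + 1)) :
    ∃ z ∈ amphora n (m + 1), IsGLB {x.toExt, y.toExt} z.toExt ∧
      z.α.psum m = min (x.α.psum m) (y.α.psum m) ∧
      x.β.psum m ≤ z.β.psum m ∧ y.β.psum m ≤ z.β.psum m ∧
      (x.β.psum m + 2 ≤ n → y.β.psum m + 2 ≤ n → z.β.psum m + 2 ≤ n) := by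
  obtain ⟨a, ha, hap⟩ := Dis.exists_isGLB_pair x.α y.α
  obtain ⟨b, hb, hbl, hb1, hb2, hb3⟩ := Dis.exists_isLUB_pair hx.2 hy.2
  have hal : a.len = m + 1 := by
    have h1 := (Dis.len_eq_iff _).1 hx.1
    have h2 := (Dis.len_eq_iff _).1 hy.1
    rw [Dis.len_eq_iff, hap, hap]
    omega
  have hab : a ≤ b := (ha.1 (show x.α ∈ ({x.α, y.α} : Set _) by simp)).trans
    (x.maj.trans (hb.1 (by simp)))
  exact ⟨⟨a, b, hab, Or.inl (hal.trans hbl.symm)⟩, ⟨hal, hbl⟩, isGLB_toExt ha hb, hap m,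
    hb1, hb2, hb3⟩

/-- The join of two blocks of an amphora. -/
theorem exists_join {m : ℕ} {x y : SBlock n} (hx : x ∈ amphora n (m + 1))
    (hy : y ∈ amphora n (m + 1)) :
    ∃ j, IsLUB {x.toExt, y.toExt} j ∧
      (∃ a b : Dis n, IsLUB {x.α, y.α} a ∧ IsGLB {x.β, y.β} b ∧ (j = ⊤ ↔ ¬ a ≤ b)) ∧
      (j = ⊤ ∨ ∃ z ∈ amphora n (m + 1), z.toExt = j ∧
        z.β.psum m = min (x.β.psum m) (y.β.psum m) ∧
        x.α.psum m ≤ z.α.psum m ∧ y.α.psum m ≤ z.α.psum m ∧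
        (x.α.psum m + 2 ≤ n → y.α.psum m + 2 ≤ n → z.α.psum m + 2 ≤ n)) := by
  obtain ⟨b, hb, hbp⟩ := Dis.exists_isGLB_pair x.β y.β
  obtain ⟨a, ha, hal, ha1, ha2, ha3⟩ := Dis.exists_isLUB_pair hx.1 hy.1
  have hbl : b.len = m + 1 := by
    have h1 := (Dis.len_eq_iff _).1 hx.2
    have h2 := (Dis.len_eq_iff _).1 hy.2
    rw [Dis.len_eq_iff, hbp, hbp]
    omega
  by_cases hab : a ≤ b
  · let z : SBlock n := ⟨a, b, hab, Or.inl (hal.trans hbl.symm)⟩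
    exact ⟨z.toExt, isLUB_toExt ha hb,
      ⟨a, b, ha, hb, iff_of_false z.toExt_ne_top (not_not.2 hab)⟩,
      Or.inr ⟨z, ⟨hal, hbl⟩, rfl, hbp m, ha1, ha2, ha3⟩⟩
  · exact ⟨⊤, isLUB_top ha hb hab, ⟨a, b, ha, hb, iff_of_true rfl hab⟩, Or.inl rfl⟩

end SBlock

/-! ## NG-blocks in terms of their last parts -/

theorem amphora_zero {n : ℕ} (hn : 0 < n) : amphora n 0 = ∅ := by
  ext x
  refine iff_of_false (fun h => ?_) (Set.notMem_empty x)
  have h1 := x.α.psum_of_len_le (i := 0) h.1.le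
  rw [Dis.psum_zero] at h1
  omega

theorem mem_NG1_iff {n m : ℕ} {x : SBlock n} :
    x ∈ NG1 n (m + 1) ↔ x ∈ amphora n (m + 1) ∧ x.β.psum m + 1 = n := by
  refine and_congr_right fun hx => ?_
  have h1 := (Dis.len_eq_iff _).1 hx.2
  have h2 := x.β.psum_succ m
  constructor
  · rintro ⟨N, G, hG, hb⟩
    have := (hb.isNG hx.1 hx.2).2.1.1 hG.2
    omega
  · intro h
    obtain ⟨N, G, hb⟩ := x.exists_isBlockOf hx.1 hx.2
    obtain ⟨h3, h4, -⟩ := hb.isNG hx.1 hx.2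
    exact ⟨N, G, ⟨h3, h4.2 (by omega)⟩, hb⟩

theorem mem_NG2_iff {n m : ℕ} {x : SBlock n} :
    x ∈ NG2 n (m + 1) ↔ x ∈ amphora n (m + 1) ∧ x.α.psum m + 2 ≤ n := by
  refine and_congr_right fun hx => ?_
  have h1 := (Dis.len_eq_iff _).1 hx.1
  have h2 := x.α.psum_succ m
  constructor
  · rintro ⟨N, G, hG, hb⟩
    have := (hb.isNG hx.1 hx.2).2.2.1 hG.2
    omega
  · intro h
    obtain ⟨N, G, hb⟩ := x.exists_isBlockOf hx.1 hx.2
    obtain ⟨h3, -, h4⟩ := hb.isNG hx.1 hx.2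
    exact ⟨N, G, ⟨h3, h4.2 (by omega)⟩, hb⟩

theorem psum_bounds {n m : ℕ} {x : SBlock n} (hx : x ∈ amphora n (m + 1)) :
    x.α.psum m ≤ x.β.psum m ∧ x.β.psum m < n :=
  ⟨Dis.le_iff.1 x.maj m, ((Dis.len_eq_iff _).1 hx.2).1⟩

/-- Failure of NG-2 pushes the sum for `α` to `n - 1`, and `α ≤ β` then forces the NG-1 condition on
`β`. -/
theorem mem_NG1Star_iff {n m : ℕ} {x : SBlock n} :
    x ∈ NG1Star n (m + 1) ↔ x ∈ amphora n (m + 1) ∧ x.α.psum m + 1 = n := by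
  rw [NG1Star, Set.mem_sdiff, mem_NG1_iff, mem_NG2_iff, and_assoc]
  refine and_congr_right fun hx => ?_
  have := psum_bounds hx
  simp only [hx, true_and]
  omega

theorem mem_NG2Star_iff {n m : ℕ} {x : SBlock n} :
    x ∈ NG2Star n (m + 1) ↔ x ∈ amphora n (m + 1) ∧ x.β.psum m + 2 ≤ n := by
  rw [NG2Star, Set.mem_sdiff, mem_NG1_iff, mem_NG2_iff, and_assoc]
  refine and_congr_right fun hx => ?_
  have := psum_bounds hx
  simp only [hx, true_and]
  omega

/-- A table row, from the partial sums of the first `m` parts of the halves of the meet and the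
join. -/
theorem tableRow_of_psum {n m : ℕ} {S T M : Set (SBlock n)} {J : Set (ExtSBlock n)}
    (hS : S ⊆ amphora n (m + 1)) (hT : T ⊆ amphora n (m + 1))
    (hM : ∀ x ∈ S, ∀ y ∈ T, ∀ z ∈ amphora n (m + 1),
      z.α.psum m = min (x.α.psum m) (y.α.psum m) →
      x.β.psum m ≤ z.β.psum m → y.β.psum m ≤ z.β.psum m →
      (x.β.psum m + 2 ≤ n → y.β.psum m + 2 ≤ n → z.β.psum m + 2 ≤ n) → z ∈ M)
    (htop : ⊤ ∈ J)
    (hJ : ∀ x ∈ S, ∀ y ∈ T, ∀ z ∈ amphora n (m + 1),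
      z.β.psum m = min (x.β.psum m) (y.β.psum m) →
      x.α.psum m ≤ z.α.psum m → y.α.psum m ≤ z.α.psum m →
      (x.α.psum m + 2 ≤ n → y.α.psum m + 2 ≤ n → z.α.psum m + 2 ≤ n) → z.toExt ∈ J) :
    TableRow S T M J := by
  intro x hx y hy
  obtain ⟨z, hz, hglb, h1, h2, h3, h4⟩ := SBlock.exists_meet (hS hx) (hT hy)
  obtain ⟨j, hlub, hab, hj⟩ := SBlock.exists_join (hS hx) (hT hy)
  refine ⟨⟨z, hM x hx y hy z hz h1 h2 h3 h4, hglb⟩, j, ?_, hlub, hab⟩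
  rcases hj with rfl | ⟨w, hw, rfl, e1, e2, e3, e4⟩
  · exact htop
  · exact hJ x hx y hy w hw e1 e2 e3 e4

theorem tableRow_of_empty {n : ℕ} {S T M : Set (SBlock n)} {J : Set (ExtSBlock n)}
    (hS : S ⊆ ∅) : TableRow S T M J := fun _ hx => (hS hx).elim

theorem top_mem_orTop {n : ℕ} (S : Set (SBlock n)) : ⊤ ∈ orTop S := Or.inr rfl

theorem toExt_mem_orTop {n : ℕ} {S : Set (SBlock n)} {z : SBlock n} (h : z ∈ S) :
    z.toExt ∈ orTop S := Or.inl ⟨z, h, rfl⟩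

end SplitBlock

theorem theorem5p5 (n k : ℕ) (hn : 0 < n) (hk : (k + 1).choose 2 ≤ n) :
    SplitBlock.TableRow (SplitBlock.NG1 n k) (SplitBlock.NG1 n k)
      (SplitBlock.NG1 n k) (SplitBlock.orTop (SplitBlock.NG1 n k)) ∧
    SplitBlock.TableRow (SplitBlock.NG2 n k) (SplitBlock.NG2 n k)
      (SplitBlock.NG2 n k) (SplitBlock.orTop (SplitBlock.NG2 n k)) ∧
    SplitBlock.TableRow (SplitBlock.NG1Star n k) (SplitBlock.NG1Star n k)
      (SplitBlock.NG1Star n k) (SplitBlock.orTop (SplitBlock.NG1Star n k)) ∧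
    SplitBlock.TableRow (SplitBlock.NG2Star n k) (SplitBlock.NG2Star n k)
      (SplitBlock.NG2Star n k) (SplitBlock.orTop (SplitBlock.NG2Star n k)) ∧
    SplitBlock.TableRow (SplitBlock.NG1Star n k) (SplitBlock.NG2Star n k)
      (SplitBlock.NG1 n k ∩ SplitBlock.NG2 n k) {⊤} := by
  open SplitBlock in
  rcases k with _ | m
  -- No partition of a positive `n` has 0 parts, so all the sets are empty.
  · have h := amphora_zero hn
    refine ⟨tableRow_of_empty ?_, tableRow_of_empty ?_, tableRow_of_empty ?_,
      tableRow_of_empty ?_, tableRow_of_empty ?_⟩ <;> rw [← h]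
    exacts [fun x hx => hx.1, fun x hx => hx.1, fun x hx => hx.1.1, fun x hx => hx.1.1,
      fun x hx => hx.1.1]
  · refine ⟨tableRow_of_psum (fun x hx => hx.1) (fun x hx => hx.1) ?_ (top_mem_orTop _) ?_,
      tableRow_of_psum (fun x hx => hx.1) (fun x hx => hx.1) ?_ (top_mem_orTop _) ?_,
      tableRow_of_psum (fun x hx => hx.1.1) (fun x hx => hx.1.1) ?_ (top_mem_orTop _) ?_,
      tableRow_of_psum (fun x hx => hx.1.1) (fun x hx => hx.1.1) ?_ (top_mem_orTop _) ?_,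
      tableRow_of_psum (fun x hx => hx.1.1) (fun x hx => hx.1.1) ?_ rfl ?_⟩
    all_goals
      intro x hx y hy z hz h1 h2 h3 h4
      have hzb := psum_bounds hz
      simp only [mem_NG1_iff, mem_NG2_iff, mem_NG1Star_iff, mem_NG2Star_iff] at hx hy
      have hxb := psum_bounds hx.1
      have hyb := psum_bounds hy.1
    · exact mem_NG1_iff.2 ⟨hz, by omega⟩
    · exact toExt_mem_orTop (mem_NG1_iff.2 ⟨hz, by omega⟩)
    · exact mem_NG2_iff.2 ⟨hz, by omega⟩
    · exact toExt_mem_orTop (mem_NG2_iff.2 ⟨hz, by omega⟩)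
    · exact mem_NG1Star_iff.2 ⟨hz, by omega⟩
    · exact toExt_mem_orTop (mem_NG1Star_iff.2 ⟨hz, by omega⟩)
    · exact mem_NG2Star_iff.2 ⟨hz, by omega⟩
    · exact toExt_mem_orTop (mem_NG2Star_iff.2 ⟨hz, by omega⟩)
    · exact ⟨mem_NG1_iff.2 ⟨hz, by omega⟩, mem_NG2_iff.2 ⟨hz, by omega⟩⟩
    -- A join block is impossible: its `α` inherits a sum of at least `n - 1` from `x`, its `β` a
    -- sum of at most `n - 2` from `y`, against `α ≤ β`.
    · omega
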